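/- Let $M$ be a smooth manifold and $H$ a real closed 3-form on $M$. On $\mathbb{T}M=TM\oplus T^*M$ use the pairing $\langle X+\alpha,Y+\beta\rangle=\iota_X\beta+\iota_Y\alpha$ and the bracket $[X+\alpha,Y+\beta]_H=[X,Y]+\mathcal{L}_X\beta-\iota_Yd\alpha+\iota_X\iota_YH$. Let $(\mathbb{J}_A,\mathbb{J}_B)$ be a generalized Kähler structure on $(M,H)$: commuting complex structures on the vector bundle $\mathbb{T}M$ whose $+i$ eigenbundles $L_A,L_B\subset\mathbb{T}_{\mathbb{C}}M$ are maximal isotropic and $[\cdot,\cdot]_H$-involutive, with $\langle\mathbb{J}_A\cdot,\mathbb{J}_B\cdot\rangle$ positive definite. Assume that the splitting $\mathbb{T}M=TM\oplus T^*M$ is the one determined by the generalized metric, i.e. $\mathbb{J}_A\mathbb{J}_B(TM)\subset T^*M$. Then there are a Riemannian metric $g$ and integrable $g$-orthogonal complex structures $I_+,I_-$ on $M$, and they are unique, such that $$\mathbb{J}_A=\tfrac12\begin{pmatrix}I_++I_-&(I_+-I_-)g^{-1}\\ g(I_+-I_-)&-(I_+^*+I_-^*)\end{pmatrix},\qquad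 \mathbb{J}_B=\tfrac12\begin{pmatrix}I_+-I_-&(I_++I_-)g^{-1}\\ g(I_++I_-)&-(I_+^*-I_-^*)\end{pmatrix}.$$ The Hermitian forms $\omega_\pm=gI_\pm$ satisfy $d^c_+\omega_+=-d^c_-\omega_-=H$, where $d^c_\pm=i(\bar\partial_\pm-\partial_\pm)$. Put $X_\pm=(M,I_\pm)$, $\mathbb{T}_{1,0}X_\pm=T_{1,0}X_\pm\oplus T^*_{1,0}X_\pm$, and $\mathcal{H}_\pm=\mp2i\,\partial_\pm\omega_\pm$. Then $\mathcal{H}_\pm$ is a closed 3-form of type $(2,1)$. The bundle $\mathbb{T}_{1,0}X_\pm$, with the Dolbeault operator $\overline{D}_Xu=\pi_{1,0}[X,u]_{\mathcal{H}_\pm}$ ($X\in T_{0,1}X_\pm$), the bracket $\pi_{1,0}[u,v]_{\mathcal{H}_\pm}$, and the canonical pairing and anchor, is a holomorphic Courant algebroid $\mathcal{E}_\pm$ on $X_\pm$. With the gauge transformations $e^{B}(X+\alpha)=X+\alpha+\iota_XB$, put $$\mathcal{A}_+=\mathbb{T}_{1,0}X_+\cap e^{-i\omega_+}(\overline{L}_A),\quad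 \mathcal{B}_+=\mathbb{T}_{1,0}X_+\cap e^{-i\omega_+}(\overline{L}_B),\quad \mathcal{A}_-=\mathbb{T}_{1,0}X_-\cap e^{i\omega_-}(\overline{L}_A),\quad \mathcal{B}_-=\mathbb{T}_{1,0}X_-\cap e^{i\omega_-}(L_B).$$ Then $\mathcal{A}_\pm$ and $\mathcal{B}_\pm$ are holomorphic Dirac structures in $\mathcal{E}_\pm$ (maximal isotropic subbundles, preserved by $\overline{D}$ and closed under the bracket), and $\mathcal{E}_\pm=\mathcal{A}_\pm\oplus\mathcal{B}_\pm$. That is, $(\mathcal{E}_\pm,\mathcal{A}_\pm,\mathcal{B}_\pm)$ are holomorphic Manin triples on $X_\pm$. -/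

import Mathlib

open scoped Manifold ContDiff

noncomputable section

namespace GenKahler

/-! ## Smooth functions, complex vector fields and complex differential forms

`M` is a smooth manifold modelled on the finite-dimensional real vector space `E`.  Everything is
written in terms of smooth sections: a smooth complex vector field, i.e. a section of the
complexified tangent bundle, is a derivation of the algebra `C^∞(M, ℂ)`, and a smooth complex
differential form is an alternating `C^∞(M, ℂ)`-multilinear map on vector fields.  A smooth
subbundle is a complemented submodule of a module of sections, and a smooth bundle map is a
`C^∞(M, ℂ)`-linear map; such a map comes from a map of real bundles iff it commutes with complex
conjugation. -/

section Calculus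

instance instContMDiffRingComplex : ContMDiffRing 𝓘(ℝ, ℂ) ∞ ℂ :=
  { instNormedSpaceLieAddGroup with
    contMDiff_mul := by
      rw [contMDiff_iff]
      refine ⟨continuous_mul, fun x y => ?_⟩
      simp only [mfld_simps, chartAt_self_eq]
      rw [contDiffOn_univ]
      exact contDiff_mul }

/-- The algebra `C^∞(M, ℂ)`. -/
abbrev Fn (E M : Type*) [NormedAddCommGroup E] [NormedSpace ℝ E] [TopologicalSpace M]
    [ChartedSpace E M] : Type _ :=
  C^∞⟮𝓘(ℝ, E), M; 𝓘(ℝ, ℂ), ℂ⟯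

variable {E M : Type*} [NormedAddCommGroup E] [NormedSpace ℝ E] [TopologicalSpace M]
  [ChartedSpace E M]

/-- Constant functions, as a ring homomorphism `ℂ → C^∞(M, ℂ)`. -/
def constHom : ℂ →+* Fn E M where
  toFun c := ⟨fun _ => c, contMDiff_const⟩
  map_one' := rfl
  map_mul' _ _ := rfl
  map_zero' := rfl
  map_add' _ _ := rfl

instance instAlgebraComplexFn : Algebra ℂ (Fn E M) := constHom.toAlgebra

/-- The complex conjugate of a function. -/
def conjFn (f : Fn E M) : Fn E M :=
  ⟨fun x => starRingEnd ℂ (f x), Complex.conjCLE.contDiff.comp_contMDiff f.contMDiff⟩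

theorem conjFn_add (f g : Fn E M) : conjFn (f + g) = conjFn f + conjFn g := by
  ext x; exact map_add (starRingEnd ℂ) (f x) (g x)

theorem conjFn_mul (f g : Fn E M) : conjFn (f * g) = conjFn f * conjFn g := by
  ext x; exact map_mul (starRingEnd ℂ) (f x) (g x)

theorem conjFn_conjFn (f : Fn E M) : conjFn (conjFn f) = f := by
  ext x; exact Complex.conj_conj (f x)

theorem conjFn_smul (c : ℂ) (f : Fn E M) : conjFn (c • f) = starRingEnd ℂ c • conjFn f := by
  ext x; exact map_mul (starRingEnd ℂ) c (f x)

end Calculus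

/-- Smooth complex vector fields: sections of `T_ℂ M`. The Lie bracket is the commutator. -/
abbrev VF (E M : Type*) [NormedAddCommGroup E] [NormedSpace ℝ E] [TopologicalSpace M]
    [ChartedSpace E M] : Type _ :=
  Derivation ℂ (Fn E M) (Fn E M)

/-- Smooth complex 1-forms: sections of `T_ℂ^* M`. -/
abbrev Form1 (E M : Type*) [NormedAddCommGroup E] [NormedSpace ℝ E] [TopologicalSpace M]
    [ChartedSpace E M] : Type _ :=
  VF E M →ₗ[Fn E M] Fn E M

/-- Smooth complex differential forms of degree `k`. -/
abbrev Form (k : ℕ) (E M : Type*) [NormedAddCommGroup E] [NormedSpace ℝ E] [TopologicalSpace M]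
    [ChartedSpace E M] : Type _ :=
  VF E M [⋀^Fin k]→ₗ[Fn E M] Fn E M

/-- Smooth sections of the generalized tangent bundle `𝕋_ℂ M = T_ℂ M ⊕ T_ℂ^* M`. -/
abbrev GT (E M : Type*) [NormedAddCommGroup E] [NormedSpace ℝ E] [TopologicalSpace M]
    [ChartedSpace E M] : Type _ :=
  VF E M × Form1 E M

section Calculus

variable {E M : Type*} [NormedAddCommGroup E] [NormedSpace ℝ E] [TopologicalSpace M]
  [ChartedSpace E M]

/-- The complex conjugate of a vector field. -/
def conjVF (X : VF E M) : VF E M :=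
  Derivation.mk'
    { toFun := fun f => conjFn (X (conjFn f))
      map_add' := fun f g => by rw [conjFn_add, map_add, conjFn_add]
      map_smul' := fun c f => by
        rw [conjFn_smul, Derivation.map_smul, conjFn_smul, Complex.conj_conj]; rfl }
    (fun f g => by
      simp only [LinearMap.coe_mk, AddHom.coe_mk, conjFn_mul, Derivation.leibniz, conjFn_add,
        smul_eq_mul, conjFn_conjFn])

theorem conjVF_apply (X : VF E M) (f : Fn E M) : conjVF X f = conjFn (X (conjFn f)) := rfl

theorem conjVF_add (X Y : VF E M) : conjVF (X + Y) = conjVF X + conjVF Y := by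
  ext1 f
  simp only [conjVF_apply, Derivation.add_apply, conjFn_add]

theorem conjVF_smul (f : Fn E M) (X : VF E M) : conjVF (f • X) = conjFn f • conjVF X := by
  ext1 h
  simp only [conjVF_apply, Derivation.smul_apply, smul_eq_mul, conjFn_mul]

/-- The complex conjugate of a 1-form. -/
def conjForm1 (α : Form1 E M) : Form1 E M where
  toFun X := conjFn (α (conjVF X))
  map_add' X Y := by rw [conjVF_add, map_add, conjFn_add]
  map_smul' f X := by
    rw [conjVF_smul, map_smul, smul_eq_mul, conjFn_mul, conjFn_conjFn]; rfl

/-- Complex conjugation on `𝕋_ℂ M`. -/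
def conjGT (u : GT E M) : GT E M := (conjVF u.1, conjForm1 u.2)

theorem conjGT_add (u v : GT E M) : conjGT (u + v) = conjGT u + conjGT v := by
  refine Prod.ext (conjVF_add u.1 v.1) ?_
  ext1 X
  exact conjFn_add (u.2 (conjVF X)) (v.2 (conjVF X))

theorem conjGT_smul (f : Fn E M) (u : GT E M) : conjGT (f • u) = conjFn f • conjGT u := by
  refine Prod.ext (conjVF_smul f u.1) ?_
  ext1 X
  exact conjFn_mul f (u.2 (conjVF X))

/-- The complex conjugate `L̄` of a subbundle `L ⊆ 𝕋_ℂ M`. -/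
def conjSub (L : Submodule (Fn E M) (GT E M)) : Submodule (Fn E M) (GT E M) where
  carrier := {u | conjGT u ∈ L}
  add_mem' {u v} hu hv := by
    change conjGT (u + v) ∈ L
    rw [conjGT_add]; exact L.add_mem hu hv
  zero_mem' := by
    have h : conjGT (0 : GT E M) = 0 := by
      have h := conjGT_add (0 : GT E M) 0
      rw [add_zero] at h
      exact left_eq_add.mp h
    change conjGT (0 : GT E M) ∈ L
    rw [h]; exact L.zero_mem
  smul_mem' f u hu := by
    change conjGT (f • u) ∈ L
    rw [conjGT_smul]; exact L.smul_mem _ hu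

/-- A form is real if it commutes with complex conjugation. -/
def IsRealForm {k : ℕ} (η : Form k E M) : Prop :=
  ∀ v : Fin k → VF E M, η (fun i => conjVF (v i)) = conjFn (η v)

theorem lie_smul_right (X Y : VF E M) (f : Fn E M) : ⁅X, f • Y⁆ = f • ⁅X, Y⁆ + (X f) • Y := by
  ext1 h
  simp only [Derivation.commutator_apply, Derivation.add_apply, Derivation.smul_apply,
    smul_eq_mul, Derivation.leibniz]
  ring

theorem lie_smul_left (X Y : VF E M) (f : Fn E M) : ⁅f • X, Y⁆ = f • ⁅X, Y⁆ - (Y f) • X := by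
  ext1 h
  simp only [Derivation.commutator_apply, Derivation.sub_apply, Derivation.smul_apply,
    smul_eq_mul, Derivation.leibniz]
  ring

/-- The differential of a function: `df(X) = X f`. -/
def dFn (f : Fn E M) : Form1 E M where
  toFun X := X f
  map_add' _ _ := rfl
  map_smul' _ _ := rfl

/-- Interior product with the exterior derivative of a 1-form:
`(ι_X dα)(Z) = X(α(Z)) - Z(α(X)) - α([X, Z])`. -/
def contrD (X : VF E M) (α : Form1 E M) : Form1 E M where
  toFun Z := X (α Z) - Z (α X) - α ⁅X, Z⁆
  map_add' Y Z := by
    simp only [map_add, lie_add, Derivation.add_apply]; ring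
  map_smul' f Z := by
    simp only [map_smul, lie_smul_right, map_add, Derivation.smul_apply, smul_eq_mul, Derivation.leibniz,
      RingHom.id_apply]
    ring

/-- The Lie derivative of a 1-form: `(𝓛_X β)(Z) = X(β(Z)) - β([X, Z])`. -/
def lieForm1 (X : VF E M) (β : Form1 E M) : Form1 E M where
  toFun Z := X (β Z) - β ⁅X, Z⁆
  map_add' Y Z := by
    simp only [map_add, lie_add]; ring
  map_smul' f Z := by
    simp only [map_smul, lie_smul_right, map_add, smul_eq_mul, Derivation.leibniz, RingHom.id_apply]
    ring

theorem form2_add_right (B : Form 2 E M) (X Y Z : VF E M) :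
    B ![X, Y + Z] = B ![X, Y] + B ![X, Z] := by
  have e : ∀ W : VF E M, Function.update ![X, 0] 1 W = ![X, W] := fun W => by
    ext1 i; fin_cases i <;> rfl
  have h := B.map_update_add ![X, 0] 1 Y Z
  rwa [e, e, e] at h

theorem form2_smul_right (B : Form 2 E M) (X Y : VF E M) (f : Fn E M) :
    B ![X, f • Y] = f * B ![X, Y] := by
  have e : ∀ W : VF E M, Function.update ![X, 0] 1 W = ![X, W] := fun W => by
    ext1 i; fin_cases i <;> rfl
  have h := B.map_update_smul ![X, 0] 1 f Y
  rwa [e, e] at h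

theorem form2_self (B : Form 2 E M) (X : VF E M) : B ![X, X] = 0 :=
  B.map_eq_zero_of_eq ![X, X] (i := 0) (j := 1) rfl (by decide)

theorem form2_add_left (B : Form 2 E M) (X Y Z : VF E M) :
    B ![X + Y, Z] = B ![X, Z] + B ![Y, Z] :=
  B.map_vecCons_add ![Z] X Y

theorem form2_smul_left (B : Form 2 E M) (X Y : VF E M) (f : Fn E M) :
    B ![f • X, Y] = f * B ![X, Y] :=
  B.map_vecCons_smul ![Y] f X

theorem form2_swap (B : Form 2 E M) (X Y : VF E M) : B ![X, Y] = - B ![Y, X] := by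
  have h := form2_self B (X + Y)
  rw [form2_add_left, form2_add_right, form2_add_right, form2_self, form2_self, zero_add,
    add_zero] at h
  exact eq_neg_of_add_eq_zero_left h

theorem form2_zero_left (B : Form 2 E M) (X : VF E M) : B ![0, X] = 0 := by
  have h := form2_smul_left B 0 X 0
  rwa [zero_smul, zero_mul] at h

theorem form2_sub_left (B : Form 2 E M) (X Y Z : VF E M) :
    B ![X - Y, Z] = B ![X, Z] - B ![Y, Z] := by
  have h := form2_add_left B (X - Y) Y Z
  rw [sub_add_cancel] at h
  exact eq_sub_of_add_eq h.symm

/-- `ι_X B = B(X, ·)` for a 2-form `B`. -/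
def contr2 (B : Form 2 E M) (X : VF E M) : Form1 E M where
  toFun Z := B ![X, Z]
  map_add' Y Z := form2_add_right B X Y Z
  map_smul' f Z := form2_smul_right B X Z f

/-- `ι_X ι_Y H = H(Y, X, ·)` for a 3-form `H`. -/
def contr3 (H : Form 3 E M) (X Y : VF E M) : Form1 E M where
  toFun Z := H ![Y, X, Z]
  map_add' Z W := by
    have e : ∀ W : VF E M, Function.update ![Y, X, 0] 2 W = ![Y, X, W] := fun W => by
      ext1 i; fin_cases i <;> rfl
    have h := H.map_update_add ![Y, X, 0] 2 Z W
    rwa [e, e, e] at h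
  map_smul' f Z := by
    have e : ∀ W : VF E M, Function.update ![Y, X, 0] 2 W = ![Y, X, W] := fun W => by
      ext1 i; fin_cases i <;> rfl
    have h := H.map_update_smul ![Y, X, 0] 2 f Z
    rwa [e, e] at h

/-- The exterior derivative of a 2-form:
`dB(X, Y, Z) = X B(Y, Z) - Y B(X, Z) + Z B(X, Y) - B([X, Y], Z) + B([X, Z], Y) - B([Y, Z], X)`. -/
def d2 (B : Form 2 E M) : Form 3 E M where
  toFun v :=
    (v 0) (B ![v 1, v 2]) - (v 1) (B ![v 0, v 2]) + (v 2) (B ![v 0, v 1])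
      - B ![⁅v 0, v 1⁆, v 2] + B ![⁅v 0, v 2⁆, v 1] - B ![⁅v 1, v 2⁆, v 0]
  map_update_add' {inst} v i X Y := by
    obtain rfl : inst = instDecidableEqFin 3 := Subsingleton.elim _ _
    fin_cases i <;> simp [form2_add_left, form2_add_right] <;> ring
  map_update_smul' {inst} v i f X := by
    obtain rfl : inst = instDecidableEqFin 3 := Subsingleton.elim _ _
    fin_cases i
    · simp [form2_smul_left, form2_smul_right, lie_smul_left, form2_sub_left]
      ring
    · simp [form2_smul_left, form2_smul_right, lie_smul_left, form2_sub_left, form2_add_left]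
      rw [form2_swap B (v 0) X]
      ring
    · simp [form2_smul_left, form2_smul_right, form2_add_left]
      rw [form2_swap B (v 0) X, form2_swap B (v 1) X]
      ring
  map_eq_zero_of_eq' v i j hv hij := by
    have hs := form2_swap B
    fin_cases i <;> fin_cases j <;> simp at hij hv <;>
      simp [hv, form2_self, form2_zero_left]
    · rw [hs (v 2) (v 1), ← lie_skew (v 1) (v 2)]
      have h := form2_smul_left B ⁅v 1, v 2⁆ (v 2) (-1)
      simp at h
      simp [h]
    · rw [hs (v 1) (v 0), ← lie_skew (v 0) (v 1)]
      have h := form2_smul_left B ⁅v 0, v 1⁆ (v 0) (-1)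
      simp at h
      simp [h]

/-- A 3-form `H` is closed: its exterior derivative, evaluated on four vector fields, is zero. -/
def IsClosed3 (H : Form 3 E M) : Prop :=
  ∀ X Y Z W : VF E M,
    X (H ![Y, Z, W]) - Y (H ![X, Z, W]) + Z (H ![X, Y, W]) - W (H ![X, Y, Z])
      - H ![⁅X, Y⁆, Z, W] + H ![⁅X, Z⁆, Y, W] - H ![⁅X, W⁆, Y, Z]
      - H ![⁅Y, Z⁆, X, W] + H ![⁅Y, W⁆, X, Z] - H ![⁅Z, W⁆, X, Y] = 0

/-- The section `u` of `𝕋_ℂ M` vanishes at the point `x`. -/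
def VanishesAt (u : GT E M) (x : M) : Prop :=
  (∀ f : Fn E M, u.1 f x = 0) ∧ ∀ Y : VF E M, u.2 Y x = 0

/-! ## The generalized tangent bundle -/

/-- The pairing `⟨X + α, Y + β⟩ = ι_X β + ι_Y α`. -/
def pairing (u v : GT E M) : Fn E M := v.2 u.1 + u.2 v.1

/-- The `H`-twisted Courant bracket
`[X + α, Y + β]_H = [X, Y] + 𝓛_X β - ι_Y dα + ι_X ι_Y H`. -/
def courantBracket (H : Form 3 E M) (u v : GT E M) : GT E M :=
  (⁅u.1, v.1⁆, lieForm1 u.1 v.2 - contrD v.1 u.2 + contr3 H u.1 v.1)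

/-- The gauge transformation `e^B : X + α ↦ X + α + ι_X B`. -/
def gauge (B : Form 2 E M) : GT E M →ₗ[Fn E M] GT E M where
  toFun u := (u.1, u.2 + contr2 B u.1)
  map_add' u v := by
    refine Prod.ext rfl ?_
    ext1 Z
    change (u.2 Z + v.2 Z) + B ![u.1 + v.1, Z] = (u.2 Z + B ![u.1, Z]) + (v.2 Z + B ![v.1, Z])
    rw [form2_add_left]; ring
  map_smul' f u := by
    refine Prod.ext rfl ?_
    ext1 Z
    change f * u.2 Z + B ![f • u.1, Z] = f * (u.2 Z + B ![u.1, Z])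
    rw [form2_smul_left]; ring

/-- The constant function `i`. -/
abbrev cI : Fn E M := algebraMap ℂ (Fn E M) Complex.I

/-- The `+i` eigenbundle of an endomorphism of `𝕋_ℂ M`. -/
def eigenbundle (J : GT E M →ₗ[Fn E M] GT E M) : Submodule (Fn E M) (GT E M) :=
  Module.End.eigenspace J cI

/-- `L` is a maximal isotropic (Lagrangian) subbundle of `F`: it equals its own orthogonal
complement in `F`. -/
def IsLagrangianIn (F L : Submodule (Fn E M) (GT E M)) : Prop :=
  L ≤ F ∧ ∀ u ∈ F, u ∈ L ↔ ∀ v ∈ L, pairing u v = 0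

/-- A generalized complex structure on `(M, H)`: a (real) complex structure on the vector bundle
`𝕋 M` whose `+i` eigenbundle is maximal isotropic and involutive for the `H`-twisted bracket. -/
structure IsGeneralizedComplex (H : Form 3 E M) (J : GT E M →ₗ[Fn E M] GT E M) : Prop where
  real : ∀ u, J (conjGT u) = conjGT (J u)
  sq : ∀ u, J (J u) = -u
  lagrangian : IsLagrangianIn ⊤ (eigenbundle J)
  involutive : ∀ u ∈ eigenbundle J, ∀ v ∈ eigenbundle J, courantBracket H u v ∈ eigenbundle J

/-- A generalized Kähler structure on `(M, H)`: a pair of commuting generalized complex structures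
such that `⟨J_A ·, J_B ·⟩` is positive definite on `𝕋 M`. -/
structure IsGeneralizedKahler (H : Form 3 E M) (JA JB : GT E M →ₗ[Fn E M] GT E M) : Prop where
  genA : IsGeneralizedComplex H JA
  genB : IsGeneralizedComplex H JB
  comm : ∀ u, JA (JB u) = JB (JA u)
  pos : ∀ u : GT E M, conjGT u = u → ∀ x : M, ¬ VanishesAt u x →
    0 < (pairing (JA u) (JB u) x).re

end Calculus

/-! ## Complex manifolds -/

/-- A complex structure on `M`: an integrable almost complex structure `I`. -/
@[ext]
structure ComplexStructure (E M : Type*) [NormedAddCommGroup E] [NormedSpace ℝ E]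
    [TopologicalSpace M] [ChartedSpace E M] where
  I : VF E M →ₗ[Fn E M] VF E M
  real : ∀ X, I (conjVF X) = conjVF (I X)
  sq : ∀ X, I (I X) = -X
  integrable : ∀ X ∈ Module.End.eigenspace I cI, ∀ Y ∈ Module.End.eigenspace I cI,
    ⁅X, Y⁆ ∈ Module.End.eigenspace I cI

namespace ComplexStructure

variable {E M : Type*} [NormedAddCommGroup E] [NormedSpace ℝ E] [TopologicalSpace M]
  [ChartedSpace E M] (C : ComplexStructure E M)

/-- `T_{1,0} X`, the `+i` eigenbundle of `I`. -/
def T10 : Submodule (Fn E M) (VF E M) := Module.End.eigenspace C.I cI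

/-- `T_{0,1} X`, the `-i` eigenbundle of `I`. -/
def T01 : Submodule (Fn E M) (VF E M) := Module.End.eigenspace C.I (-cI)

/-- `𝕋_{1,0} X = T_{1,0} X ⊕ T_{1,0}^* X`, where `T_{1,0}^* X` is the annihilator of `T_{0,1} X`. -/
def GT10 : Submodule (Fn E M) (GT E M) := C.T10.prod C.T01.dualAnnihilator

/-- The projection `(1 - i I) / 2` of `T_ℂ M` onto `T_{1,0} X`. -/
def P10 : VF E M →ₗ[Fn E M] VF E M := (1 / 2 : ℂ) • (LinearMap.id - Complex.I • C.I)

/-- The projection `(1 + i I) / 2` of `T_ℂ M` onto `T_{0,1} X`. -/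
def P01 : VF E M →ₗ[Fn E M] VF E M := (1 / 2 : ℂ) • (LinearMap.id + Complex.I • C.I)

/-- The projection `π_{1,0}` of `𝕋_ℂ M` onto `𝕋_{1,0} X` along `𝕋_{0,1} X`. -/
def proj10 (u : GT E M) : GT E M := (C.P10 u.1, u.2.comp C.P10)

theorem form3_self01 (η : Form 3 E M) (X Y : VF E M) : η ![X, X, Y] = 0 :=
  η.map_eq_zero_of_eq ![X, X, Y] (i := 0) (j := 1) rfl (by decide)

theorem form3_self02 (η : Form 3 E M) (X Y : VF E M) : η ![X, Y, X] = 0 :=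
  η.map_eq_zero_of_eq ![X, Y, X] (i := 0) (j := 2) rfl (by decide)

theorem form3_self12 (η : Form 3 E M) (X Y : VF E M) : η ![X, Y, Y] = 0 :=
  η.map_eq_zero_of_eq ![X, Y, Y] (i := 1) (j := 2) rfl (by decide)

theorem form3_swap01 (η : Form 3 E M) (X Y Z : VF E M) : η ![X, Y, Z] = -η ![Y, X, Z] := by
  rw [← η.map_swap ![Y, X, Z] (i := 0) (j := 1) (by decide)]
  congr 1; ext1 m; fin_cases m <;> rfl

theorem form3_swap02 (η : Form 3 E M) (X Y Z : VF E M) : η ![X, Y, Z] = -η ![Z, Y, X] := by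
  rw [← η.map_swap ![Z, Y, X] (i := 0) (j := 2) (by decide)]
  congr 1; ext1 m; fin_cases m <;> rfl

theorem form3_swap12 (η : Form 3 E M) (X Y Z : VF E M) : η ![X, Y, Z] = -η ![X, Z, Y] := by
  rw [← η.map_swap ![X, Z, Y] (i := 1) (j := 2) (by decide)]
  congr 1; ext1 m; fin_cases m <;> rfl

/-- Auxiliary to `mixed`: the underlying multilinear map. -/
def mixedMultilinear (P Q : VF E M →ₗ[Fn E M] VF E M) (η : Form 3 E M) :
    MultilinearMap (Fn E M) (fun _ : Fin 3 => VF E M) (Fn E M) :=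
  η.toMultilinearMap.compLinearMap ![Q, P, P] + η.toMultilinearMap.compLinearMap ![P, Q, P] +
    η.toMultilinearMap.compLinearMap ![P, P, Q]

theorem mixedMultilinear_apply (P Q : VF E M →ₗ[Fn E M] VF E M) (η : Form 3 E M)
    (v : Fin 3 → VF E M) :
    mixedMultilinear P Q η v = η ![Q (v 0), P (v 1), P (v 2)] + η ![P (v 0), Q (v 1), P (v 2)] +
      η ![P (v 0), P (v 1), Q (v 2)] := by
  have e : ∀ f : Fin 3 → VF E M →ₗ[Fn E M] VF E M,
      η.toMultilinearMap.compLinearMap f v = η ![f 0 (v 0), f 1 (v 1), f 2 (v 2)] := fun f => by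
    change η (fun m => f m (v m)) = _
    congr 1; ext1 m; fin_cases m <;> rfl
  change η.toMultilinearMap.compLinearMap _ v + η.toMultilinearMap.compLinearMap _ v +
    η.toMultilinearMap.compLinearMap _ v = _
  rw [e, e, e]; rfl

/-- For linear maps `P` and `Q`, the 3-form
`(X, Y, Z) ↦ η(Q X, P Y, P Z) + η(P X, Q Y, P Z) + η(P X, P Y, Q Z)`. -/
def mixed (P Q : VF E M →ₗ[Fn E M] VF E M) (η : Form 3 E M) : Form 3 E M where
  toMultilinearMap := mixedMultilinear P Q η
  map_eq_zero_of_eq' v i j hv hij := by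
    change mixedMultilinear P Q η v = 0
    rw [mixedMultilinear_apply]
    fin_cases i <;> fin_cases j <;> simp at hij hv <;>
      simp only [hv, form3_self01, form3_self02, form3_self12, add_zero, zero_add]
    · exact add_eq_zero_iff_eq_neg.mpr (form3_swap01 η _ _ _)
    · exact add_eq_zero_iff_eq_neg.mpr (form3_swap02 η _ _ _)
    · exact add_eq_zero_iff_eq_neg.mpr (form3_swap01 η _ _ _)
    · exact add_eq_zero_iff_eq_neg.mpr (form3_swap12 η _ _ _)
    · exact add_eq_zero_iff_eq_neg.mpr (form3_swap02 η _ _ _)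
    · exact add_eq_zero_iff_eq_neg.mpr (form3_swap12 η _ _ _)

/-- The component `η^{2,1}` of a 3-form `η`. -/
def comp21 (η : Form 3 E M) : Form 3 E M := mixed C.P10 C.P01 η

/-- The component `η^{1,2}` of a 3-form `η`. -/
def comp12 (η : Form 3 E M) : Form 3 E M := mixed C.P01 C.P10 η

/-- `∂φ`, for a form `φ` of type `(1,1)`. -/
def del (φ : Form 2 E M) : Form 3 E M := C.comp21 (d2 φ)

/-- `∂̄φ`, for a form `φ` of type `(1,1)`. -/
def delbar (φ : Form 2 E M) : Form 3 E M := C.comp12 (d2 φ)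

/-- `d^c φ = i (∂̄ - ∂) φ`, for a form `φ` of type `(1,1)`. -/
def dc (φ : Form 2 E M) : Form 3 E M := Complex.I • (C.delbar φ - C.del φ)

/-! ## Holomorphic Courant algebroids and Dirac structures -/

/-- The Dolbeault operator `D̄_X u = π_{1,0} [X, u]_𝓗` on `𝕋_{1,0} X` determined by a 3-form `𝓗`,
for `X` a section of `T_{0,1} X` and `u` a section of `𝕋_{1,0} X`. -/
def dolbeault (𝓗 : Form 3 E M) (X : VF E M) (u : GT E M) : GT E M :=
  C.proj10 (courantBracket 𝓗 (X, 0) u)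

/-- The bracket `[u, v]_{1,0} = π_{1,0} [u, v]_𝓗` on smooth sections of `𝕋_{1,0} X`. -/
def bracket10 (𝓗 : Form 3 E M) (u v : GT E M) : GT E M :=
  C.proj10 (courantBracket 𝓗 u v)

/-- The section `u` is holomorphic on `U` for the Dolbeault operator `D`. -/
def IsHolomorphicOn (D : VF E M → GT E M → GT E M) (U : Set M) (u : GT E M) : Prop :=
  ∀ X ∈ C.T01, ∀ x ∈ U, VanishesAt (D X u) x

/-- `(𝕋_{1,0} X, D, [·,·])`, with the canonical pairing and the canonical projection to `T_{1,0} X`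
as anchor, is a holomorphic (exact) Courant algebroid: `D` is a flat `T_{0,1}`-connection
(a holomorphic structure) for which pairing and anchor are holomorphic, the bracket satisfies the
axioms of a Courant algebroid, and it preserves (local) holomorphic sections. -/
structure IsHolomorphicCourantAlgebroid (D : VF E M → GT E M → GT E M)
    (br : GT E M → GT E M → GT E M) : Prop where
  D_mem : ∀ X ∈ C.T01, ∀ u ∈ C.GT10, D X u ∈ C.GT10
  D_add : ∀ X ∈ C.T01, ∀ u ∈ C.GT10, ∀ v ∈ C.GT10, D X (u + v) = D X u + D X v
  D_leibniz : ∀ X ∈ C.T01, ∀ u ∈ C.GT10, ∀ f : Fn E M, D X (f • u) = f • D X u + X f • u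
  D_add_left : ∀ X ∈ C.T01, ∀ Y ∈ C.T01, ∀ u ∈ C.GT10, D (X + Y) u = D X u + D Y u
  D_smul_left : ∀ X ∈ C.T01, ∀ u ∈ C.GT10, ∀ f : Fn E M, D (f • X) u = f • D X u
  D_flat : ∀ X ∈ C.T01, ∀ Y ∈ C.T01, ∀ u ∈ C.GT10, D X (D Y u) - D Y (D X u) = D ⁅X, Y⁆ u
  D_pairing : ∀ X ∈ C.T01, ∀ u ∈ C.GT10, ∀ v ∈ C.GT10,
    X (pairing u v) = pairing (D X u) v + pairing u (D X v)
  D_anchor : ∀ X ∈ C.T01, ∀ u ∈ C.GT10, (D X u).1 = C.P10 ⁅X, u.1⁆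
  br_mem : ∀ u ∈ C.GT10, ∀ v ∈ C.GT10, br u v ∈ C.GT10
  br_add : ∀ u ∈ C.GT10, ∀ v ∈ C.GT10, ∀ w ∈ C.GT10, br u (v + w) = br u v + br u w
  br_add_left : ∀ u ∈ C.GT10, ∀ v ∈ C.GT10, ∀ w ∈ C.GT10, br (u + v) w = br u w + br v w
  br_leibniz : ∀ u ∈ C.GT10, ∀ v ∈ C.GT10, ∀ f : Fn E M, br u (f • v) = f • br u v + u.1 f • v
  br_jacobi : ∀ u ∈ C.GT10, ∀ v ∈ C.GT10, ∀ w ∈ C.GT10,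
    br u (br v w) = br (br u v) w + br v (br u w)
  br_anchor : ∀ u ∈ C.GT10, ∀ v ∈ C.GT10, (br u v).1 = ⁅u.1, v.1⁆
  br_pairing : ∀ u ∈ C.GT10, ∀ v ∈ C.GT10, ∀ w ∈ C.GT10,
    u.1 (pairing v w) = pairing (br u v) w + pairing v (br u w)
  br_symm : ∀ u ∈ C.GT10, ∀ v ∈ C.GT10, br u v + br v u = C.proj10 (0, dFn (pairing u v))
  br_holomorphic : ∀ U : Set M, IsOpen U → ∀ u ∈ C.GT10, ∀ v ∈ C.GT10,
    C.IsHolomorphicOn D U u → C.IsHolomorphicOn D U v → C.IsHolomorphicOn D U (br u v)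

/-- `A` is a holomorphic Dirac structure in `(𝕋_{1,0} X, D, [·,·])`: a maximal isotropic holomorphic
subbundle (i.e. a smooth subbundle preserved by `D`) which is closed under the bracket. -/
structure IsHolomorphicDirac (D : VF E M → GT E M → GT E M) (br : GT E M → GT E M → GT E M)
    (A : Submodule (Fn E M) (GT E M)) : Prop where
  subbundle : ∃ N : Submodule (Fn E M) (GT E M), A ⊓ N = ⊥ ∧ A ⊔ N = C.GT10
  lagrangian : IsLagrangianIn C.GT10 A
  holomorphic : ∀ X ∈ C.T01, ∀ u ∈ A, D X u ∈ A
  involutive : ∀ u ∈ A, ∀ v ∈ A, br u v ∈ A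

/-- `𝓗` is a closed 3-form of type `(2,1) + (3,0)` and, for the holomorphic Courant algebroid `𝓔`
on `X` that it defines, `𝓔 = A ⊕ B` with holomorphic Dirac structures `A` and `B`. -/
structure IsHolomorphicManinTriple (𝓗 : Form 3 E M) (A B : Submodule (Fn E M) (GT E M)) :
    Prop where
  closed : IsClosed3 𝓗
  type : ∀ X ∈ C.T01, ∀ Y ∈ C.T01, ∀ Z, 𝓗 ![X, Y, Z] = 0
  courant : C.IsHolomorphicCourantAlgebroid (C.dolbeault 𝓗) (C.bracket10 𝓗)
  diracA : C.IsHolomorphicDirac (C.dolbeault 𝓗) (C.bracket10 𝓗) A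
  diracB : C.IsHolomorphicDirac (C.dolbeault 𝓗) (C.bracket10 𝓗) B
  disjoint : A ⊓ B = ⊥
  span : A ⊔ B = C.GT10

end ComplexStructure

/-! ## Bi-Hermitian data -/

/-- A Riemannian metric `g` (as an isomorphism `T M → T^* M`) with two complex structures
`I_+`, `I_-`, each of them orthogonal for `g`. -/
@[ext]
structure BiHermitian (E M : Type*) [NormedAddCommGroup E] [NormedSpace ℝ E]
    [TopologicalSpace M] [ChartedSpace E M] where
  g : VF E M ≃ₗ[Fn E M] Form1 E M
  Xp : ComplexStructure E M
  Xm : ComplexStructure E M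
  g_symm : ∀ X Y, g X Y = g Y X
  g_real : ∀ X Y, g (conjVF X) (conjVF Y) = conjFn (g X Y)
  g_pos : ∀ X : VF E M, conjVF X = X → ∀ x : M, ¬ VanishesAt (X, 0) x → 0 < (g X X x).re
  orth_p : ∀ X Y, g (Xp.I X) (Xp.I Y) = g X Y
  orth_m : ∀ X Y, g (Xm.I X) (Xm.I Y) = g X Y

namespace BiHermitian

variable {E M : Type*} [NormedAddCommGroup E] [NormedSpace ℝ E] [TopologicalSpace M]
  [ChartedSpace E M]

/-- The Hermitian form `ω = g I`, i.e. `ω(X, Y) = g(I X, Y)`. -/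
def hermForm (g : VF E M ≃ₗ[Fn E M] Form1 E M) (g_symm : ∀ X Y, g X Y = g Y X)
    (C : ComplexStructure E M) (orth : ∀ X Y, g (C.I X) (C.I Y) = g X Y) : Form 2 E M where
  toFun v := g (C.I (v 0)) (v 1)
  map_update_add' {inst} v i X Y := by
    obtain rfl : inst = instDecidableEqFin 2 := Subsingleton.elim _ _
    fin_cases i <;> simp
  map_update_smul' {inst} v i f X := by
    obtain rfl : inst = instDecidableEqFin 2 := Subsingleton.elim _ _
    fin_cases i <;> simp
  map_eq_zero_of_eq' v i j hv hij := by
    have h : ∀ X, g (C.I X) X = 0 := fun X => by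
      have h1 := orth X (C.I X)
      rw [C.sq, map_neg, g_symm X] at h1
      have h2 : (2 : ℂ) • g (C.I X) X = 0 := by
        rw [two_smul]; exact add_eq_zero_iff_neg_eq.mpr h1
      calc g (C.I X) X = (1 / 2 : ℂ) • ((2 : ℂ) • g (C.I X) X) := by
            rw [smul_smul]; norm_num
        _ = 0 := by rw [h2, smul_zero]
    fin_cases i <;> fin_cases j <;> simp at hij hv <;> simp [hv, h]

variable (B : BiHermitian E M)

/-- `ω_+ = g I_+`. -/
def omegaP : Form 2 E M := hermForm B.g B.g_symm B.Xp B.orth_p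

/-- `ω_- = g I_-`. -/
def omegaM : Form 2 E M := hermForm B.g B.g_symm B.Xm B.orth_m

/-- The formula expressing a generalized Kähler structure by bi-Hermitian data:
`J_A = 1/2 [I_+ + I_-, (I_+ - I_-) g⁻¹; g (I_+ - I_-), -(I_+^* + I_-^*)]` and
`J_B = 1/2 [I_+ - I_-, (I_+ + I_-) g⁻¹; g (I_+ + I_-), -(I_+^* - I_-^*)]`. -/
def Represents (JA JB : GT E M →ₗ[Fn E M] GT E M) : Prop :=
  ∀ (X : VF E M) (α : Form1 E M),
    JA (X, α) = (1 / 2 : ℂ) •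
      ((B.Xp.I + B.Xm.I) X + (B.Xp.I - B.Xm.I) (B.g.symm α),
        B.g ((B.Xp.I - B.Xm.I) X) - α.comp (B.Xp.I + B.Xm.I)) ∧
    JB (X, α) = (1 / 2 : ℂ) •
      ((B.Xp.I - B.Xm.I) X + (B.Xp.I + B.Xm.I) (B.g.symm α),
        B.g ((B.Xp.I + B.Xm.I) X) - α.comp (B.Xp.I - B.Xm.I))

/-- `𝓗_+ = -2i ∂_+ ω_+`, the 3-form defining the holomorphic Courant algebroid `𝓔_+`. -/
def Hp : Form 3 E M := (-2 * Complex.I) • B.Xp.del B.omegaP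

/-- `𝓗_- = 2i ∂_- ω_-`, the 3-form defining the holomorphic Courant algebroid `𝓔_-`. -/
def Hm : Form 3 E M := (2 * Complex.I) • B.Xm.del B.omegaM

/-- `𝓐_+ = 𝕋_{1,0} X_+ ∩ e^{-iω_+}(L̄_A)`. -/
def Ap (JA : GT E M →ₗ[Fn E M] GT E M) : Submodule (Fn E M) (GT E M) :=
  B.Xp.GT10 ⊓ (conjSub (eigenbundle JA)).map (gauge (-Complex.I • B.omegaP))

/-- `𝓑_+ = 𝕋_{1,0} X_+ ∩ e^{-iω_+}(L̄_B)`. -/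
def Bp (JB : GT E M →ₗ[Fn E M] GT E M) : Submodule (Fn E M) (GT E M) :=
  B.Xp.GT10 ⊓ (conjSub (eigenbundle JB)).map (gauge (-Complex.I • B.omegaP))

/-- `𝓐_- = 𝕋_{1,0} X_- ∩ e^{iω_-}(L̄_A)`. -/
def Am (JA : GT E M →ₗ[Fn E M] GT E M) : Submodule (Fn E M) (GT E M) :=
  B.Xm.GT10 ⊓ (conjSub (eigenbundle JA)).map (gauge (Complex.I • B.omegaM))

/-- `𝓑_- = 𝕋_{1,0} X_- ∩ e^{iω_-}(L_B)`. -/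
def Bm (JB : GT E M →ₗ[Fn E M] GT E M) : Submodule (Fn E M) (GT E M) :=
  B.Xm.GT10 ⊓ (eigenbundle JB).map (gauge (Complex.I • B.omegaM))

end BiHermitian

end GenKahler

end

open GenKahler

/-! Put gX = -J_A J_B X. The product J_A J_B squares to 1 and exchanges X and gX up to sign. It
equals -1 on the graph of g, where therefore J_A = J_B, and +1 on the graph of -g, where J_A = -J_B.
Both structures preserve the two graphs. Reading J_A on them through the projection to TM yields I_+
and I_-, and since the graphs span 𝕋M this is the matrix formula and its uniqueness
(`BiHermitian.represents_iff`). The bundle L_A ∩ L_B is the graph of g over T_{1,0}X_+, and an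
intersection of involutive bundles is involutive, so I_+ is integrable.

The Manin triple arises by reduction. On T_{0,1}X_+ the form ω_+ acts as -ig, so e^{-iω_+} carries
L̄_A ∩ L̄_B, the graph of g over T_{0,1}, to T_{0,1} itself (`inf_map_gauge`). The two transformed
bundles are Dirac structures for H - i dω_+ that meet in T_{0,1}, and their sum contains 𝕋_{1,0},
which is orthogonal to T_{0,1} (`GT10_le_sup`). As T_{0,1} is closed under the twisted bracket, H -
i dω_+ vanishes on pairs of (0,1)-vectors. The Courant structure then reduces to 𝕋_{1,0}, a model of
T_{0,1}^⊥/T_{0,1}: bracketing with T_{0,1} gives the Dolbeault operator, flat by the Jacobi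
identity, and the two Dirac structures cut out complementary Dirac structures
(`isHolomorphicManinTriple_of_dirac`).

The same vanishing gives the torsion identities. H is real and ω_+ is real of type (1,1), so the
(1,2)-part of H is i∂̄ω_+, its conjugate is the (2,1)-part, and nothing else remains. Hence H = d^c
ω_+ and H - i dω_+ = -2i∂ω_+ (`dc_eq_and_del_eq`).

The minus side is the same argument for (J_A, -J_B, -g). `IsCompatiblePair` therefore isolates what
is used and omits positivity, which serves only to make g invertible and Riemannian. -/

namespace GenKahler

variable {E M : Type*} [NormedAddCommGroup E] [NormedSpace ℝ E] [TopologicalSpace M]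
  [ChartedSpace E M]

/-! ### Scalars, and separation of sections -/

theorem smul_eq_algebraMap_mul (c : ℂ) (f : Fn E M) : c • f = algebraMap ℂ (Fn E M) c * f :=
  Algebra.smul_def c f

theorem cI_mul_cI : (cI : Fn E M) * cI = -1 := by
  rw [← map_mul, Complex.I_mul_I, map_neg, map_one]

theorem cI_smul_cI {V : Type*} [AddCommGroup V] [Module (Fn E M) V] (v : V) :
    (cI : Fn E M) • (cI : Fn E M) • v = -v := by
  rw [smul_smul, cI_mul_cI, neg_one_smul]

theorem two_mul_half : (2 : Fn E M) * algebraMap ℂ (Fn E M) (1 / 2) = 1 := by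
  rw [← map_ofNat (algebraMap ℂ (Fn E M)) 2, ← map_mul]; norm_num

theorem eq_of_two_mul_eq {f g : Fn E M} (h : 2 * f = 2 * g) : f = g := by
  have h2 := two_mul_half (E := E) (M := M)
  linear_combination algebraMap ℂ (Fn E M) (1 / 2) * h - (f - g) * h2

theorem eq_of_two_smul_eq {V : Type*} [AddCommGroup V] [Module (Fn E M) V] {u v : V}
    (h : (2 : Fn E M) • u = (2 : Fn E M) • v) : u = v := by
  have h2 := congrArg (fun w => algebraMap ℂ (Fn E M) (1 / 2) • w) h
  simpa only [smul_smul, mul_comm _ (2 : Fn E M), two_mul_half, one_smul] using h2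

theorem GT_ext {u v : GT E M} (h₁ : u.1 = v.1) (h₂ : ∀ Z, u.2 Z = v.2 Z) : u = v :=
  Prod.ext h₁ (LinearMap.ext h₂)

/-- Exact forms suffice as tests, because evaluating df on X returns X f. -/
theorem form1_eq_zero_of_forall {X : VF E M} (h : ∀ α : Form1 E M, α X = 0) : X = 0 := by
  ext1 f
  exact h (dFn f)

/-! ### Conjugation -/

theorem conjFn_sub (f g : Fn E M) : conjFn (f - g) = conjFn f - conjFn g := by
  ext x; exact map_sub (starRingEnd ℂ) (f x) (g x)

theorem conjFn_neg (f : Fn E M) : conjFn (-f) = -conjFn f := by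
  ext x; exact map_neg (starRingEnd ℂ) (f x)

theorem conjFn_zero : conjFn (0 : Fn E M) = 0 := by
  ext x; exact map_zero (starRingEnd ℂ)

theorem conjFn_algebraMap (c : ℂ) :
    conjFn (algebraMap ℂ (Fn E M) c) = algebraMap ℂ (Fn E M) (starRingEnd ℂ c) := rfl

theorem conjFn_cI : conjFn (cI : Fn E M) = -cI := by
  rw [cI, conjFn_algebraMap, Complex.conj_I, map_neg]

theorem conjVF_conjVF (X : VF E M) : conjVF (conjVF X) = X := by
  ext1 f
  simp only [conjVF_apply, conjFn_conjFn]

theorem conjVF_neg (X : VF E M) : conjVF (-X) = -conjVF X := by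
  ext1 f
  simp only [conjVF_apply, Derivation.neg_apply, conjFn_neg]

theorem conjVF_lie (X Y : VF E M) : conjVF ⁅X, Y⁆ = ⁅conjVF X, conjVF Y⁆ := by
  ext1 f
  simp only [conjVF_apply, Derivation.commutator_apply, conjFn_sub, conjFn_conjFn]

theorem conjForm1_apply (α : Form1 E M) (X : VF E M) :
    conjForm1 α X = conjFn (α (conjVF X)) := rfl

theorem conjForm1_apply_conjVF (α : Form1 E M) (X : VF E M) :
    conjForm1 α (conjVF X) = conjFn (α X) := by
  rw [conjForm1_apply, conjVF_conjVF]

theorem conjForm1_conjForm1 (α : Form1 E M) : conjForm1 (conjForm1 α) = α := by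
  ext1 X
  simp only [conjForm1_apply, conjVF_conjVF, conjFn_conjFn]

theorem conjForm1_neg (α : Form1 E M) : conjForm1 (-α) = -conjForm1 α := by
  ext1 X
  exact conjFn_neg _

theorem conjForm1_zero : conjForm1 (0 : Form1 E M) = 0 := by
  ext1 X
  exact conjFn_zero

theorem conjVF_zero : conjVF (0 : VF E M) = 0 := by
  ext1 f
  exact conjFn_zero

theorem conjGT_conjGT (u : GT E M) : conjGT (conjGT u) = u :=
  Prod.ext (conjVF_conjVF u.1) (conjForm1_conjForm1 u.2)

theorem conjGT_neg (u : GT E M) : conjGT (-u) = -conjGT u :=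
  Prod.ext (conjVF_neg u.1) (conjForm1_neg u.2)

theorem conjGT_injective : Function.Injective (conjGT : GT E M → GT E M) :=
  Function.LeftInverse.injective conjGT_conjGT

theorem pairing_conjGT (u v : GT E M) :
    pairing (conjGT u) (conjGT v) = conjFn (pairing u v) := by
  change conjForm1 v.2 (conjVF u.1) + conjForm1 u.2 (conjVF v.1) = _
  rw [conjForm1_apply_conjVF, conjForm1_apply_conjVF, ← conjFn_add]; rfl

theorem mem_conjSub {L : Submodule (Fn E M) (GT E M)} {u : GT E M} :
    u ∈ conjSub L ↔ conjGT u ∈ L := Iff.rfl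

theorem courantBracket_fst (H : Form 3 E M) (u v : GT E M) :
    (courantBracket H u v).1 = ⁅u.1, v.1⁆ := rfl

theorem courantBracket_snd_apply (H : Form 3 E M) (u v : GT E M) (Z : VF E M) :
    (courantBracket H u v).2 Z = u.1 (v.2 Z) - v.2 ⁅u.1, Z⁆
      - (v.1 (u.2 Z) - Z (u.2 v.1) - u.2 ⁅v.1, Z⁆) + H ![v.1, u.1, Z] := rfl

theorem IsRealForm.apply_two {B : Form 2 E M} (hB : IsRealForm B) (X Y : VF E M) :
    B ![conjVF X, conjVF Y] = conjFn (B ![X, Y]) := by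
  rw [← hB]
  congr 1; ext1 m; fin_cases m <;> rfl

theorem IsRealForm.apply_three {H : Form 3 E M} (hH : IsRealForm H) (X Y Z : VF E M) :
    H ![conjVF X, conjVF Y, conjVF Z] = conjFn (H ![X, Y, Z]) := by
  rw [← hH]
  congr 1; ext1 m; fin_cases m <;> rfl

theorem courantBracket_conjGT {H : Form 3 E M} (hH : IsRealForm H) (u v : GT E M) :
    courantBracket H (conjGT u) (conjGT v) = conjGT (courantBracket H u v) := by
  refine GT_ext (conjVF_lie u.1 v.1).symm fun Z => ?_
  change _ = conjForm1 (courantBracket H u v).2 Z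
  obtain ⟨Z, rfl⟩ : ∃ W, conjVF W = Z := ⟨conjVF Z, conjVF_conjVF Z⟩
  rw [conjForm1_apply_conjVF, courantBracket_snd_apply, courantBracket_snd_apply]
  change conjVF u.1 (conjForm1 v.2 (conjVF Z)) - conjForm1 v.2 ⁅conjVF u.1, conjVF Z⁆
    - (conjVF v.1 (conjForm1 u.2 (conjVF Z)) - conjVF Z (conjForm1 u.2 (conjVF v.1))
      - conjForm1 u.2 ⁅conjVF v.1, conjVF Z⁆) + H ![conjVF v.1, conjVF u.1, conjVF Z] = _
  rw [hH.apply_three]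
  simp only [← conjVF_lie, conjForm1_apply_conjVF, conjVF_apply, conjFn_conjFn, conjFn_sub,
    conjFn_add]

/-! ### The pairing -/

theorem pairing_comm (u v : GT E M) : pairing u v = pairing v u := add_comm _ _

theorem pairing_add_left (u v w : GT E M) : pairing (u + v) w = pairing u w + pairing v w := by
  change w.2 (u.1 + v.1) + (u.2 w.1 + v.2 w.1) = (w.2 u.1 + u.2 w.1) + (w.2 v.1 + v.2 w.1)
  rw [map_add]; ring

theorem pairing_smul_left (f : Fn E M) (u w : GT E M) :
    pairing (f • u) w = f * pairing u w := by
  change w.2 (f • u.1) + f * (u.2 w.1) = f * (w.2 u.1 + u.2 w.1)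
  rw [map_smul, smul_eq_mul]; ring

theorem pairing_add_right (u v w : GT E M) : pairing u (v + w) = pairing u v + pairing u w := by
  simp only [pairing_comm u, pairing_add_left]

theorem pairing_smul_right (f : Fn E M) (u w : GT E M) :
    pairing u (f • w) = f * pairing u w := by
  simp only [pairing_comm u, pairing_smul_left]

theorem pairing_neg_left (u v : GT E M) : pairing (-u) v = -pairing u v := by
  have h := pairing_smul_left (-1) u v
  rwa [neg_one_smul (Fn E M) u, neg_one_mul] at h

theorem pairing_neg_right (u v : GT E M) : pairing u (-v) = -pairing u v := by
  rw [pairing_comm, pairing_neg_left, pairing_comm]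

theorem pairing_sub_right (u v w : GT E M) : pairing u (v - w) = pairing u v - pairing u w := by
  rw [sub_eq_add_neg, pairing_add_right, pairing_neg_right, sub_eq_add_neg]

theorem pairing_sub_left (u v w : GT E M) : pairing (u - v) w = pairing u w - pairing v w := by
  rw [sub_eq_add_neg, pairing_add_left, pairing_neg_left, sub_eq_add_neg]

theorem eq_zero_of_pairing_eq_zero {u : GT E M} (h : ∀ v, pairing u v = 0) : u = 0 := by
  refine GT_ext (form1_eq_zero_of_forall fun α => ?_) fun Z => ?_
  · have := h (0, α)
    simpa [pairing] using this
  · have := h (Z, 0)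
    simpa [pairing] using this

theorem pairing_vector (u : GT E M) (X : VF E M) : pairing u (X, 0) = u.2 X := by
  simp [pairing]

/-! ### The Courant bracket -/

theorem form3_add_left (η : Form 3 E M) (X X' Y Z : VF E M) :
    η ![X + X', Y, Z] = η ![X, Y, Z] + η ![X', Y, Z] :=
  η.map_vecCons_add ![Y, Z] X X'

theorem form3_smul_left (η : Form 3 E M) (X Y Z : VF E M) (f : Fn E M) :
    η ![f • X, Y, Z] = f * η ![X, Y, Z] :=
  η.map_vecCons_smul ![Y, Z] f X

theorem form3_zero_left (η : Form 3 E M) (Y Z : VF E M) : η ![0, Y, Z] = 0 := by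
  rw [← zero_smul (Fn E M) (0 : VF E M), form3_smul_left, zero_mul]

theorem form3_rotate (η : Form 3 E M) (X Y Z : VF E M) : η ![X, Y, Z] = η ![Y, Z, X] := by
  rw [ComplexStructure.form3_swap01, ComplexStructure.form3_swap12, neg_neg]

theorem form3_add_mid (η : Form 3 E M) (X Y Y' Z : VF E M) :
    η ![X, Y + Y', Z] = η ![X, Y, Z] + η ![X, Y', Z] := by
  simp only [form3_rotate η X, form3_add_left]

theorem form3_add_right (η : Form 3 E M) (X Y Z Z' : VF E M) :
    η ![X, Y, Z + Z'] = η ![X, Y, Z] + η ![X, Y, Z'] := by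
  simp only [form3_rotate η X, form3_add_mid]

theorem form3_smul_mid (η : Form 3 E M) (X Y Z : VF E M) (f : Fn E M) :
    η ![X, f • Y, Z] = f * η ![X, Y, Z] := by
  simp only [form3_rotate η X, form3_smul_left]

theorem courantBracket_add_right (H : Form 3 E M) (u v w : GT E M) :
    courantBracket H u (v + w) = courantBracket H u v + courantBracket H u w := by
  refine GT_ext (lie_add u.1 v.1 w.1) fun Z => ?_
  rw [courantBracket_snd_apply]
  change u.1 (v.2 Z + w.2 Z) - (v.2 ⁅u.1, Z⁆ + w.2 ⁅u.1, Z⁆)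
    - ((v.1 + w.1) (u.2 Z) - Z (u.2 (v.1 + w.1)) - u.2 ⁅v.1 + w.1, Z⁆) + H ![v.1 + w.1, u.1, Z]
    = (courantBracket H u v).2 Z + (courantBracket H u w).2 Z
  simp only [courantBracket_snd_apply, form3_add_left, map_add, add_lie, Derivation.add_apply]
  ring

theorem courantBracket_smul_right (H : Form 3 E M) (u v : GT E M) (f : Fn E M) :
    courantBracket H u (f • v) = f • courantBracket H u v + u.1 f • v := by
  refine GT_ext (lie_smul_right u.1 v.1 f) fun Z => ?_
  rw [courantBracket_snd_apply]
  change u.1 (f * v.2 Z) - f * v.2 ⁅u.1, Z⁆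
    - (f * v.1 (u.2 Z) - Z (u.2 (f • v.1)) - u.2 ⁅f • v.1, Z⁆) + H ![f • v.1, u.1, Z]
    = f * (courantBracket H u v).2 Z + u.1 f * v.2 Z
  simp only [courantBracket_snd_apply, form3_smul_left, map_smul, map_sub, lie_smul_left,
    Derivation.leibniz, smul_eq_mul]
  ring

theorem courantBracket_symm (H : Form 3 E M) (u v : GT E M) :
    courantBracket H u v + courantBracket H v u = (0, dFn (pairing u v)) := by
  refine GT_ext ?_ fun Z => ?_
  · change ⁅u.1, v.1⁆ + ⁅v.1, u.1⁆ = 0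
    rw [← lie_skew u.1 v.1, neg_add_cancel]
  · change (courantBracket H u v).2 Z + (courantBracket H v u).2 Z = Z (v.2 u.1 + u.2 v.1)
    simp only [courantBracket_snd_apply, map_add]
    rw [ComplexStructure.form3_swap01 H u.1]
    ring

theorem courantBracket_eq_neg_swap (H : Form 3 E M) {u v : GT E M} (h : pairing u v = 0) :
    courantBracket H u v = -courantBracket H v u := by
  have h2 := courantBracket_symm H u v
  rw [h, show ((0 : VF E M), dFn (0 : Fn E M)) = 0 from GT_ext rfl fun Z => map_zero Z] at h2
  exact eq_neg_of_add_eq_zero_left h2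

theorem courantBracket_add_left (H : Form 3 E M) (u v w : GT E M) :
    courantBracket H (u + v) w = courantBracket H u w + courantBracket H v w := by
  refine GT_ext (add_lie u.1 v.1 w.1) fun Z => ?_
  rw [courantBracket_snd_apply]
  change (u.1 + v.1) (w.2 Z) - w.2 ⁅u.1 + v.1, Z⁆
    - (w.1 (u.2 Z + v.2 Z) - Z (u.2 w.1 + v.2 w.1) - (u.2 ⁅w.1, Z⁆ + v.2 ⁅w.1, Z⁆))
      + H ![w.1, u.1 + v.1, Z]
    = (courantBracket H u w).2 Z + (courantBracket H v w).2 Z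
  simp only [courantBracket_snd_apply, form3_add_mid, map_add, add_lie, Derivation.add_apply]
  ring

theorem courantBracket_smul_left (H : Form 3 E M) (u v : GT E M) (f : Fn E M) :
    courantBracket H (f • u) v =
      f • courantBracket H u v - v.1 f • u + (0, pairing u v • dFn f) := by
  refine GT_ext ((lie_smul_left u.1 v.1 f).trans (add_zero _).symm) fun Z => ?_
  rw [courantBracket_snd_apply]
  change f * u.1 (v.2 Z) - v.2 ⁅f • u.1, Z⁆
    - (v.1 (f * u.2 Z) - Z (f * u.2 v.1) - f * u.2 ⁅v.1, Z⁆) + H ![v.1, f • u.1, Z]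
    = f * (courantBracket H u v).2 Z - v.1 f * u.2 Z + (v.2 u.1 + u.2 v.1) * Z f
  simp only [courantBracket_snd_apply, form3_smul_mid, map_smul, map_sub, lie_smul_left,
    Derivation.leibniz, smul_eq_mul]
  ring

theorem courantBracket_pairing (H : Form 3 E M) (u v w : GT E M) :
    u.1 (pairing v w) = pairing (courantBracket H u v) w + pairing v (courantBracket H u w) := by
  change u.1 (w.2 v.1 + v.2 w.1) = (w.2 ⁅u.1, v.1⁆ + (courantBracket H u v).2 w.1)
    + ((courantBracket H u w).2 v.1 + v.2 ⁅u.1, w.1⁆)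
  simp only [courantBracket_snd_apply, map_add]
  rw [← lie_skew w.1 v.1, map_neg, ComplexStructure.form3_swap02 H v.1,
    form3_rotate H w.1 u.1 v.1, form3_rotate H u.1 v.1 w.1]
  ring

/-- Up to sign, the only obstruction is dH contracted with the three vector parts; the remaining
terms cancel by the Jacobi identity of vector fields. -/
theorem courantBracket_jacobi {H : Form 3 E M} (hH : IsClosed3 H) (u v w : GT E M) :
    courantBracket H u (courantBracket H v w) =
      courantBracket H (courantBracket H u v) w + courantBracket H v (courantBracket H u w) := by
  refine GT_ext (leibniz_lie u.1 v.1 w.1) fun Z => ?_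
  change _ = (courantBracket H (courantBracket H u v) w).2 Z
    + (courantBracket H v (courantBracket H u w)).2 Z
  simp only [courantBracket_snd_apply, courantBracket_fst, map_sub, map_add, lie_lie,
    Derivation.commutator_apply]
  have h := hH u.1 v.1 w.1 Z
  have s (A B C : VF E M) := ComplexStructure.form3_swap01 H A B C
  have r (A B C : VF E M) := form3_rotate H A B C
  simp only [s w.1 v.1 Z, s w.1 u.1 Z, s v.1 u.1 Z, s v.1 u.1 w.1, ← r ⁅u.1, Z⁆, ← r ⁅v.1, Z⁆,
    ← r ⁅w.1, Z⁆, s w.1 ⁅u.1, v.1⁆, map_neg, ComplexStructure.form3_swap12 H ⁅u.1, Z⁆ w.1,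
    ComplexStructure.form3_swap12 H ⁅v.1, Z⁆ w.1, ComplexStructure.form3_swap12 H ⁅w.1, Z⁆ v.1]
  linear_combination -h

/-! ### Gauge transformations -/

theorem gauge_fst (B : Form 2 E M) (u : GT E M) : (gauge B u).1 = u.1 := rfl

theorem gauge_snd_apply (B : Form 2 E M) (u : GT E M) (Z : VF E M) :
    (gauge B u).2 Z = u.2 Z + B ![u.1, Z] := rfl

theorem gauge_neg_gauge (B : Form 2 E M) (u : GT E M) : gauge (-B) (gauge B u) = u := by
  refine GT_ext rfl fun Z => ?_
  rw [gauge_snd_apply, gauge_snd_apply, gauge_fst, AlternatingMap.neg_apply]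
  ring

theorem gauge_gauge_neg (B : Form 2 E M) (u : GT E M) : gauge B (gauge (-B) u) = u := by
  have h := gauge_neg_gauge (-B) u
  rwa [neg_neg] at h

theorem pairing_gauge (B : Form 2 E M) (u v : GT E M) :
    pairing (gauge B u) (gauge B v) = pairing u v := by
  change (v.2 u.1 + B ![v.1, u.1]) + (u.2 v.1 + B ![u.1, v.1]) = v.2 u.1 + u.2 v.1
  rw [form2_swap B v.1]
  ring

theorem form2_neg_left (B : Form 2 E M) (X Y : VF E M) : B ![-X, Y] = -B ![X, Y] := by
  rw [← zero_sub, form2_sub_left, form2_zero_left, zero_sub]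

theorem d2_apply (B : Form 2 E M) (X Y Z : VF E M) :
    d2 B ![X, Y, Z] = X (B ![Y, Z]) - Y (B ![X, Z]) + Z (B ![X, Y])
      - B ![⁅X, Y⁆, Z] + B ![⁅X, Z⁆, Y] - B ![⁅Y, Z⁆, X] := rfl

/-- The twist changes by +dB, not -dB, because the bracket contains ι_X ι_Y H = H(Y, X, ·). -/
theorem gauge_courantBracket (H : Form 3 E M) (B : Form 2 E M) (u v : GT E M) :
    gauge B (courantBracket H u v) = courantBracket (H + d2 B) (gauge B u) (gauge B v) := by
  refine GT_ext rfl fun Z => ?_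
  simp only [gauge_snd_apply, courantBracket_snd_apply, gauge_fst, courantBracket_fst,
    AlternatingMap.add_apply, d2_apply, map_add]
  rw [← lie_skew u.1 v.1, form2_swap B v.1 ⁅u.1, Z⁆, form2_swap B u.1 v.1, map_neg,
    form2_swap B u.1 ⁅v.1, Z⁆, form2_neg_left]
  ring

theorem isClosed3_d2 (B : Form 2 E M) : IsClosed3 (d2 B) := by
  intro X Y Z W
  have hJ (X Y Z W : VF E M) : B ![⁅⁅X, Y⁆, Z⁆, W] - B ![⁅⁅X, Z⁆, Y⁆, W] + B ![⁅⁅Y, Z⁆, X⁆, W] = 0 := by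
    rw [← form2_sub_left, ← form2_add_left, ← lie_skew ⁅Y, Z⁆ X, leibniz_lie X Y Z,
      ← lie_skew ⁅X, Z⁆ Y]
    convert form2_zero_left B W using 3
    abel
  simp only [d2_apply, map_add, map_sub, Derivation.commutator_apply]
  rw [form2_swap B ⁅Z, W⁆ ⁅X, Y⁆, form2_swap B ⁅Y, W⁆ ⁅X, Z⁆, form2_swap B ⁅Y, Z⁆ ⁅X, W⁆]
  -- The double brackets that remain form four Jacobi sums, one for each triple among the four
  -- vector fields.
  linear_combination hJ X Y Z W - hJ X Y W Z + hJ X Z W Y - hJ Y Z W X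

theorem IsClosed3.add {H K : Form 3 E M} (hH : IsClosed3 H) (hK : IsClosed3 K) :
    IsClosed3 (H + K) := by
  intro X Y Z W
  have h₁ := hH X Y Z W
  have h₂ := hK X Y Z W
  simp only [AlternatingMap.add_apply, map_add]
  linear_combination h₁ + h₂

/-! ### Lagrangian and involutive subbundles under conjugation and gauge transformations -/

theorem mem_map_gauge {B : Form 2 E M} {L : Submodule (Fn E M) (GT E M)} {u : GT E M} :
    u ∈ L.map (gauge B) ↔ gauge (-B) u ∈ L := by
  constructor
  · rintro ⟨v, hv, rfl⟩
    rwa [gauge_neg_gauge]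
  · exact fun h => ⟨_, h, gauge_gauge_neg B u⟩

theorem IsLagrangianIn.conjSub {L : Submodule (Fn E M) (GT E M)} (hL : IsLagrangianIn ⊤ L) :
    IsLagrangianIn ⊤ (conjSub L) := by
  refine ⟨le_top, fun u _ => ?_⟩
  rw [mem_conjSub, hL.2 _ trivial]
  constructor
  · intro h v hv
    rw [← conjFn_conjFn (pairing u v), ← pairing_conjGT, h _ hv, conjFn_zero]
  · intro h v hv
    rw [← conjGT_conjGT v, pairing_conjGT, h _ (by rwa [mem_conjSub, conjGT_conjGT]), conjFn_zero]

theorem IsLagrangianIn.map_gauge {L : Submodule (Fn E M) (GT E M)} (hL : IsLagrangianIn ⊤ L)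
    (B : Form 2 E M) : IsLagrangianIn ⊤ (L.map (gauge B)) := by
  refine ⟨le_top, fun u _ => ?_⟩
  rw [mem_map_gauge, hL.2 _ trivial]
  constructor
  · rintro h _ ⟨v, hv, rfl⟩
    rw [← gauge_gauge_neg B u, pairing_gauge, h _ hv]
  · intro h v hv
    rw [← pairing_gauge B, gauge_gauge_neg]
    exact h _ ⟨v, hv, rfl⟩

theorem involutive_conjSub {H : Form 3 E M} (hH : IsRealForm H)
    {L : Submodule (Fn E M) (GT E M)} (hL : ∀ u ∈ L, ∀ v ∈ L, courantBracket H u v ∈ L) :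
    ∀ u ∈ conjSub L, ∀ v ∈ conjSub L, courantBracket H u v ∈ conjSub L := fun u hu v hv => by
  rw [mem_conjSub, ← courantBracket_conjGT hH]
  exact hL _ hu _ hv

theorem involutive_map_gauge {H : Form 3 E M} (B : Form 2 E M)
    {L : Submodule (Fn E M) (GT E M)} (hL : ∀ u ∈ L, ∀ v ∈ L, courantBracket H u v ∈ L) :
    ∀ u ∈ L.map (gauge B), ∀ v ∈ L.map (gauge B),
      courantBracket (H + d2 B) u v ∈ L.map (gauge B) := by
  rintro _ ⟨u, hu, rfl⟩ _ ⟨v, hv, rfl⟩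
  rw [← gauge_courantBracket]
  exact ⟨_, hL _ hu _ hv, rfl⟩

/-! ### Locality -/

/-- Sections here are global, while holomorphy is tested on open sets. Multiplying by such a cutoff
turns vanishing on U into the global equation χ • w = 0, to which linearity and Leibniz rules apply.
-/
theorem exists_bump [FiniteDimensional ℝ E] [T2Space M] [IsManifold 𝓘(ℝ, E) ∞ M] {U : Set M}
    (hU : IsOpen U) {x : M} (hx : x ∈ U) :
    ∃ χ : Fn E M, χ x = 1 ∧ ∀ y ∉ U, χ y = 0 := by
  obtain ⟨f, -, hf⟩ := (SmoothBumpFunction.nhds_basis_support (I := 𝓘(ℝ, E))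
    (hU.mem_nhds hx)).mem_iff.mp (hU.mem_nhds hx)
  refine ⟨⟨fun y => (f y : ℂ), Complex.ofRealCLM.contDiff.comp_contMDiff f.contMDiff⟩, ?_, ?_⟩
  · change ((f x : ℝ) : ℂ) = 1
    rw [f.eq_one, Complex.ofReal_one]
  · intro y hy
    change ((f y : ℝ) : ℂ) = 0
    rw [Complex.ofReal_eq_zero]
    by_contra h
    exact hy (hf h)

theorem vanishesAt_zero (x : M) : VanishesAt (0 : GT E M) x :=
  ⟨fun _ => rfl, fun _ => rfl⟩

theorem VanishesAt.add {u v : GT E M} {x : M} (hu : VanishesAt u x) (hv : VanishesAt v x) :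
    VanishesAt (u + v) x := by
  refine ⟨fun f => ?_, fun Z => ?_⟩
  · change u.1 f x + v.1 f x = 0
    rw [hu.1, hv.1, add_zero]
  · change u.2 Z x + v.2 Z x = 0
    rw [hu.2, hv.2, add_zero]

theorem VanishesAt.smul {u : GT E M} {x : M} (hu : VanishesAt u x) (f : Fn E M) :
    VanishesAt (f • u) x := by
  refine ⟨fun h => ?_, fun Z => ?_⟩
  · change f x * u.1 h x = 0
    rw [hu.1, mul_zero]
  · change f x * u.2 Z x = 0
    rw [hu.2, mul_zero]

theorem VanishesAt.neg {u : GT E M} {x : M} (hu : VanishesAt u x) : VanishesAt (-u) x := by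
  rw [← neg_one_smul (Fn E M) u]
  exact hu.smul (-1)

theorem VanishesAt.sub {u v : GT E M} {x : M} (hu : VanishesAt u x) (hv : VanishesAt v x) :
    VanishesAt (u - v) x := by
  rw [sub_eq_add_neg]
  exact hu.add hv.neg

theorem vanishesAt_of_smul {u : GT E M} {x : M} {χ : Fn E M} (hχ : χ x = 1)
    (hu : VanishesAt (χ • u) x) : VanishesAt u x := by
  refine ⟨fun h => ?_, fun Z => ?_⟩
  · have h2 : χ x * u.1 h x = 0 := hu.1 h
    rwa [hχ, one_mul] at h2
  · have h2 : χ x * u.2 Z x = 0 := hu.2 Z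
    rwa [hχ, one_mul] at h2

theorem smul_eq_zero_of_vanishesAt {u : GT E M} {U : Set M} (hu : ∀ x ∈ U, VanishesAt u x)
    {χ : Fn E M} (hχ : ∀ y ∉ U, χ y = 0) : χ • u = 0 := by
  refine GT_ext ?_ fun Z => ?_
  · ext1 h
    ext y
    change χ y * u.1 h y = 0
    by_cases hy : y ∈ U
    · rw [(hu y hy).1, mul_zero]
    · rw [hχ y hy, zero_mul]
  · ext y
    change χ y * u.2 Z y = 0
    by_cases hy : y ∈ U
    · rw [(hu y hy).2, mul_zero]
    · rw [hχ y hy, zero_mul]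

theorem eq_zero_of_vanishesAt {u : GT E M} (hu : ∀ x, VanishesAt u x) : u = 0 := by
  have h := smul_eq_zero_of_vanishesAt (U := Set.univ) (fun x _ => hu x) (χ := 1)
    (fun y hy => (hy trivial).elim)
  rwa [one_smul] at h

section Local

variable [FiniteDimensional ℝ E] [T2Space M] [IsManifold 𝓘(ℝ, E) ∞ M]
  {U : Set M} {w : GT E M}

theorem vanishesAt_map_of_isOpen (hU : IsOpen U) (hw : ∀ x ∈ U, VanishesAt w x)
    (T : GT E M →ₗ[Fn E M] GT E M) : ∀ x ∈ U, VanishesAt (T w) x := by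
  intro x hx
  obtain ⟨χ, hχ, hχ0⟩ := exists_bump (E := E) hU hx
  refine vanishesAt_of_smul hχ ?_
  rw [← map_smul, smul_eq_zero_of_vanishesAt hw hχ0, map_zero]
  exact vanishesAt_zero x

theorem pairing_eq_zero_of_isOpen (hU : IsOpen U) (hw : ∀ x ∈ U, VanishesAt w x)
    (u : GT E M) : ∀ x ∈ U, pairing u w x = 0 := by
  intro x hx
  obtain ⟨χ, hχ, hχ0⟩ := exists_bump (E := E) hU hx
  have h : χ x * pairing u w x = 0 := by
    have h2 := pairing_smul_right χ u w
    rw [smul_eq_zero_of_vanishesAt hw hχ0] at h2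
    have h3 : pairing u (0 : GT E M) = 0 := by
      have h4 := pairing_smul_right 0 u 0
      rwa [zero_smul, zero_mul] at h4
    rw [h3] at h2
    exact (congrArg (fun f : Fn E M => f x) h2).symm
  rwa [hχ, one_mul] at h

/-- With χw = 0 the Leibniz rule gives χ[u, w] = -u(χ)w, and w vanishes at x. -/
theorem vanishesAt_courantBracket_right (H : Form 3 E M) (hU : IsOpen U)
    (hw : ∀ x ∈ U, VanishesAt w x) (u : GT E M) :
    ∀ x ∈ U, VanishesAt (courantBracket H u w) x := by
  intro x hx
  obtain ⟨χ, hχ, hχ0⟩ := exists_bump (E := E) hU hx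
  refine vanishesAt_of_smul hχ ?_
  rw [← add_sub_cancel_right (χ • courantBracket H u w) (u.1 χ • w), ← courantBracket_smul_right,
    smul_eq_zero_of_vanishesAt hw hχ0]
  have h : courantBracket H u 0 = 0 := by
    have h2 := courantBracket_add_right H u 0 0
    rw [add_zero] at h2
    exact left_eq_add.mp h2
  rw [h]
  exact (vanishesAt_zero x).sub ((hw x hx).smul _)

theorem vanishesAt_courantBracket_left (H : Form 3 E M) (hU : IsOpen U)
    (hw : ∀ x ∈ U, VanishesAt w x) (u : GT E M) :
    ∀ x ∈ U, VanishesAt (courantBracket H w u) x := by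
  intro x hx
  rw [eq_sub_of_add_eq (courantBracket_symm H w u)]
  refine VanishesAt.sub ?_ (vanishesAt_courantBracket_right H hU hw u x hx)
  obtain ⟨χ, hχ, hχ0⟩ := exists_bump (E := E) hU hx
  have h0 : χ * pairing w u = 0 := by
    ext y
    change χ y * pairing w u y = 0
    by_cases hy : y ∈ U
    · rw [pairing_comm, pairing_eq_zero_of_isOpen hU hw u y hy, mul_zero]
    · rw [hχ0 y hy, zero_mul]
  -- The remaining term is the differential of p = ⟨w, u⟩. As χp = 0 everywhere, the Leibniz rule at
  -- x, where χ = 1 and p = 0, gives Z p = 0.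
  refine ⟨fun f => rfl, fun Z => ?_⟩
  have h1 : χ x * Z (pairing w u) x + pairing w u x * Z χ x = 0 := by
    have h2 := Z.leibniz χ (pairing w u)
    rw [h0, map_zero] at h2
    exact (congrArg (fun f : Fn E M => f x) h2).symm
  have h2 : pairing w u x = 0 := by rw [pairing_comm, pairing_eq_zero_of_isOpen hU hw u x hx]
  rwa [hχ, one_mul, h2, zero_mul, add_zero] at h1

end Local

namespace ComplexStructure

variable (C : ComplexStructure E M)

/-! ### Type decomposition of vectors and of generalized vectors -/

theorem mem_T10 {X : VF E M} : X ∈ C.T10 ↔ C.I X = (cI : Fn E M) • X := Module.End.mem_eigenspace_iff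

theorem mem_T01 {X : VF E M} : X ∈ C.T01 ↔ C.I X = -((cI : Fn E M) • X) := by
  rw [← neg_smul]; exact Module.End.mem_eigenspace_iff

theorem P10_apply (X : VF E M) :
    C.P10 X = algebraMap ℂ (Fn E M) (1 / 2) • (X - (cI : Fn E M) • C.I X) := by
  rw [algebraMap_smul, cI, algebraMap_smul]; rfl

theorem P01_apply (X : VF E M) :
    C.P01 X = algebraMap ℂ (Fn E M) (1 / 2) • (X + (cI : Fn E M) • C.I X) := by
  rw [algebraMap_smul, cI, algebraMap_smul]; rfl

theorem P10_add_P01 (X : VF E M) : C.P10 X + C.P01 X = X := by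
  rw [P10_apply, P01_apply, ← smul_add]
  refine eq_of_two_smul_eq (E := E) (M := M) ?_
  rw [smul_smul, two_mul_half, one_smul, two_smul]
  abel

theorem P10_mem (X : VF E M) : C.P10 X ∈ C.T10 := by
  rw [mem_T10, P10_apply, map_smul, smul_comm (cI : Fn E M), map_sub, map_smul, C.sq,
    smul_sub (cI : Fn E M), cI_smul_cI, smul_neg, sub_neg_eq_add, sub_neg_eq_add, add_comm]

theorem P01_mem (X : VF E M) : C.P01 X ∈ C.T01 := by
  rw [mem_T01, P01_apply, map_smul, smul_comm (cI : Fn E M), ← smul_neg, map_add, map_smul, C.sq,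
    smul_add (cI : Fn E M), cI_smul_cI, smul_neg]
  congr 1
  abel

theorem P01_eq_zero {X : VF E M} (hX : X ∈ C.T10) : C.P01 X = 0 := by
  rw [P01_apply, C.mem_T10.mp hX, smul_smul, cI_mul_cI, neg_one_smul, add_neg_cancel, smul_zero]

theorem P10_eq_zero {X : VF E M} (hX : X ∈ C.T01) : C.P10 X = 0 := by
  rw [P10_apply, C.mem_T01.mp hX, smul_neg, smul_smul, cI_mul_cI, neg_one_smul, neg_neg, sub_self,
    smul_zero]

theorem P10_eq_self {X : VF E M} (hX : X ∈ C.T10) : C.P10 X = X := by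
  have h := C.P10_add_P01 X
  rwa [C.P01_eq_zero hX, add_zero] at h

theorem lie_mem_T10 {X Y : VF E M} (hX : X ∈ C.T10) (hY : Y ∈ C.T10) : ⁅X, Y⁆ ∈ C.T10 :=
  C.integrable X hX Y hY

theorem conjVF_mem_T10 {X : VF E M} (hX : X ∈ C.T01) : conjVF X ∈ C.T10 := by
  rw [mem_T10, C.real, C.mem_T01.mp hX, conjVF_neg, conjVF_smul, conjFn_cI, neg_smul, neg_neg]

theorem conjVF_mem_T01 {X : VF E M} (hX : X ∈ C.T10) : conjVF X ∈ C.T01 := by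
  rw [mem_T01, C.real, C.mem_T10.mp hX, conjVF_smul, conjFn_cI, neg_smul]

theorem lie_mem_T01 {X Y : VF E M} (hX : X ∈ C.T01) (hY : Y ∈ C.T01) : ⁅X, Y⁆ ∈ C.T01 := by
  have h := C.conjVF_mem_T01 (C.lie_mem_T10 (C.conjVF_mem_T10 hX) (C.conjVF_mem_T10 hY))
  rwa [conjVF_lie, conjVF_conjVF, conjVF_conjVF] at h

theorem mem_GT10 {u : GT E M} : u ∈ C.GT10 ↔ u.1 ∈ C.T10 ∧ ∀ Y ∈ C.T01, u.2 Y = 0 :=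
  Iff.and Iff.rfl (Submodule.mem_dualAnnihilator u.2)

/-- The projection `π_{1,0}` as a linear map. -/
noncomputable def proj10Linear : GT E M →ₗ[Fn E M] GT E M where
  toFun := C.proj10
  map_add' u v := GT_ext (map_add C.P10 u.1 v.1) fun _ => rfl
  map_smul' f u := GT_ext (map_smul C.P10 f u.1) fun _ => rfl

theorem proj10_add (u v : GT E M) : C.proj10 (u + v) = C.proj10 u + C.proj10 v :=
  map_add C.proj10Linear u v

theorem proj10_sub (u v : GT E M) : C.proj10 (u - v) = C.proj10 u - C.proj10 v :=
  map_sub C.proj10Linear u v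

theorem proj10_smul (f : Fn E M) (u : GT E M) : C.proj10 (f • u) = f • C.proj10 u :=
  map_smul C.proj10Linear f u

theorem proj10_snd_apply (u : GT E M) (Z : VF E M) : (C.proj10 u).2 Z = u.2 (C.P10 Z) := rfl

theorem proj10_mem (u : GT E M) : C.proj10 u ∈ C.GT10 :=
  C.mem_GT10.mpr ⟨C.P10_mem _, fun Y hY => by
    rw [proj10_snd_apply, C.P10_eq_zero hY, map_zero]⟩

theorem proj10_eq_self {u : GT E M} (hu : u ∈ C.GT10) : C.proj10 u = u := by
  obtain ⟨h₁, h₂⟩ := C.mem_GT10.mp hu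
  refine GT_ext (C.P10_eq_self h₁) fun Z => ?_
  rw [proj10_snd_apply]
  conv_rhs => rw [← C.P10_add_P01 Z, map_add, h₂ _ (C.P01_mem Z), add_zero]

theorem proj10_vector {X : VF E M} (hX : X ∈ C.T01) : C.proj10 (X, 0) = 0 :=
  GT_ext (C.P10_eq_zero hX) fun _ => rfl

/-- A section of the orthogonal complement of `T_{0,1} X` differs from its `(1,0)`-part by a
section of `T_{0,1} X`. -/
theorem eq_proj10_add {u : GT E M} (hu : ∀ Y ∈ C.T01, u.2 Y = 0) :
    u = C.proj10 u + (C.P01 u.1, 0) := by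
  refine GT_ext (C.P10_add_P01 u.1).symm fun Z => ?_
  change u.2 Z = u.2 (C.P10 Z) + 0
  conv_lhs => rw [← C.P10_add_P01 Z, map_add, hu _ (C.P01_mem Z)]

/-! ### The holomorphic Courant algebroid of a form of type `(2,1) + (3,0)` -/

variable {C} {𝓗 : Form 3 E M}

theorem courantBracket_vector_vector (ht : ∀ X ∈ C.T01, ∀ Y ∈ C.T01, ∀ Z, 𝓗 ![X, Y, Z] = 0)
    {X Y : VF E M} (hX : X ∈ C.T01) (hY : Y ∈ C.T01) :
    courantBracket 𝓗 (X, 0) (Y, 0) = (⁅X, Y⁆, 0) := by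
  refine GT_ext rfl fun Z => ?_
  rw [courantBracket_snd_apply]
  simp [ht Y hY X hX Z]

/-- Bracketing with T_{0,1} preserves its orthogonal complement, by invariance of the pairing,
because T_{0,1} is itself closed under the twisted bracket. -/
theorem courantBracket_vector_snd (ht : ∀ X ∈ C.T01, ∀ Y ∈ C.T01, ∀ Z, 𝓗 ![X, Y, Z] = 0)
    {X : VF E M} (hX : X ∈ C.T01) {u : GT E M} (hu : ∀ Y ∈ C.T01, u.2 Y = 0) :
    ∀ Y ∈ C.T01, (courantBracket 𝓗 (X, 0) u).2 Y = 0 := by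
  intro Y hY
  have h := courantBracket_pairing 𝓗 (X, 0) u (Y, 0)
  rw [courantBracket_vector_vector ht hX hY] at h
  simp only [pairing_vector, hu Y hY, hu _ (C.lie_mem_T01 hX hY), map_zero, add_zero] at h
  exact h.symm

theorem courantBracket_vector_eq (ht : ∀ X ∈ C.T01, ∀ Y ∈ C.T01, ∀ Z, 𝓗 ![X, Y, Z] = 0)
    {X : VF E M} (hX : X ∈ C.T01) {u : GT E M} (hu : u ∈ C.GT10) :
    courantBracket 𝓗 (X, 0) u = C.dolbeault 𝓗 X u + (C.P01 ⁅X, u.1⁆, 0) :=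
  C.eq_proj10_add (courantBracket_vector_snd ht hX (C.mem_GT10.mp hu).2)

theorem pairing_vector_GT10 {X : VF E M} (hX : X ∈ C.T01) {u : GT E M} (hu : u ∈ C.GT10) :
    pairing u (X, 0) = 0 := by
  rw [pairing_vector, (C.mem_GT10.mp hu).2 X hX]

/-- The bracket of two sections of `𝕋_{1,0} X` differs from its `(1,0)`-part by a form. -/
theorem courantBracket_eq_bracket10_add {u v : GT E M} (hu : u ∈ C.GT10) (hv : v ∈ C.GT10) :
    courantBracket 𝓗 u v = C.bracket10 𝓗 u v + (0, (courantBracket 𝓗 u v).2.comp C.P01) := by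
  have h := C.lie_mem_T10 (C.mem_GT10.mp hu).1 (C.mem_GT10.mp hv).1
  refine GT_ext ?_ fun Z => ?_
  · change ⁅u.1, v.1⁆ = C.P10 ⁅u.1, v.1⁆ + 0
    rw [C.P10_eq_self h, add_zero]
  · change _ = (courantBracket 𝓗 u v).2 (C.P10 Z) + (courantBracket 𝓗 u v).2 (C.P01 Z)
    rw [← map_add, C.P10_add_P01]

/-- Forms that kill T_{1,0} still do so after a Lie derivative along T_{1,0}, since T_{1,0} is
involutive. With its left-hand counterpart, this lets the projection in an iterated bracket be
postponed to the outermost step. -/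
theorem proj10_courantBracket_form_right {u : GT E M} (hu : u ∈ C.GT10) (γ : Form1 E M) :
    C.proj10 (courantBracket 𝓗 u (0, γ.comp C.P01)) = 0 := by
  refine GT_ext ?_ fun Z => ?_
  · change C.P10 ⁅u.1, 0⁆ = 0
    rw [lie_zero, map_zero]
  · have h := C.P10_mem Z
    rw [proj10_snd_apply, courantBracket_snd_apply]
    simp [C.P01_eq_zero h, C.P01_eq_zero (C.lie_mem_T10 (C.mem_GT10.mp hu).1 h),
      form3_zero_left]

theorem proj10_courantBracket_form_left {u : GT E M} (hu : u ∈ C.GT10) (γ : Form1 E M) :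
    C.proj10 (courantBracket 𝓗 (0, γ.comp C.P01) u) = 0 := by
  refine GT_ext ?_ fun Z => ?_
  · change C.P10 ⁅0, u.1⁆ = 0
    rw [zero_lie, map_zero]
  · have h := C.P10_mem Z
    have hu1 := (C.mem_GT10.mp hu).1
    rw [proj10_snd_apply, courantBracket_snd_apply]
    simp [C.P01_eq_zero h, C.P01_eq_zero hu1, C.P01_eq_zero (C.lie_mem_T10 hu1 h),
      form3_rotate 𝓗 u.1 0, form3_zero_left]

theorem bracket10_bracket10 {u v w : GT E M} (hu : u ∈ C.GT10) (hv : v ∈ C.GT10)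
    (hw : w ∈ C.GT10) : C.bracket10 𝓗 u (C.bracket10 𝓗 v w) =
      C.proj10 (courantBracket 𝓗 u (courantBracket 𝓗 v w)) := by
  conv_rhs => rw [courantBracket_eq_bracket10_add hv hw, courantBracket_add_right, proj10_add,
    proj10_courantBracket_form_right hu, add_zero]
  rfl

theorem bracket10_bracket10_left {u v w : GT E M} (hu : u ∈ C.GT10) (hv : v ∈ C.GT10)
    (hw : w ∈ C.GT10) : C.bracket10 𝓗 (C.bracket10 𝓗 u v) w =
      C.proj10 (courantBracket 𝓗 (courantBracket 𝓗 u v) w) := by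
  conv_rhs => rw [courantBracket_eq_bracket10_add hu hv, courantBracket_add_left, proj10_add,
    proj10_courantBracket_form_left hw, add_zero]
  rfl

/-- The inner projection can be dropped: it discards a section of T_{0,1}, whose bracket with X is
again in T_{0,1} and so is killed by the outer projection. -/
theorem proj10_courantBracket_dolbeault (ht : ∀ X ∈ C.T01, ∀ Y ∈ C.T01, ∀ Z, 𝓗 ![X, Y, Z] = 0)
    {X Y : VF E M} (hX : X ∈ C.T01) (hY : Y ∈ C.T01) {u : GT E M} (hu : u ∈ C.GT10) :
    C.dolbeault 𝓗 X (C.dolbeault 𝓗 Y u) =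
      C.proj10 (courantBracket 𝓗 (X, 0) (courantBracket 𝓗 (Y, 0) u)) := by
  conv_rhs => rw [courantBracket_vector_eq ht hY hu, courantBracket_add_right, proj10_add,
    courantBracket_vector_vector ht hX (C.P01_mem _), C.proj10_vector (C.lie_mem_T01 hX (C.P01_mem _)),
    add_zero]
  rfl

theorem pairing_proj10 {u v : GT E M} (hv : v ∈ C.GT10) : pairing (C.proj10 u) v = pairing u v := by
  obtain ⟨h₁, h₂⟩ := C.mem_GT10.mp hv
  change v.2 (C.P10 u.1) + u.2 (C.P10 v.1) = v.2 u.1 + u.2 v.1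
  rw [C.P10_eq_self h₁]
  conv_rhs => rw [← C.P10_add_P01 u.1, map_add, h₂ _ (C.P01_mem _), add_zero]

/-- This is the projected Jacobi identity for X, u, v, after splitting each inner bracket into its
(1,0)-part and a remainder. The operator is not a derivation of the bracket on smooth sections, but
every correction term will vanish where u and v are holomorphic. -/
theorem dolbeault_bracket10 (hc : IsClosed3 𝓗)
    (ht : ∀ X ∈ C.T01, ∀ Y ∈ C.T01, ∀ Z, 𝓗 ![X, Y, Z] = 0)
    {X : VF E M} (hX : X ∈ C.T01) {u v : GT E M} (hu : u ∈ C.GT10) (hv : v ∈ C.GT10) :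
    C.dolbeault 𝓗 X (C.bracket10 𝓗 u v) =
      C.bracket10 𝓗 (C.dolbeault 𝓗 X u) v + C.bracket10 𝓗 u (C.dolbeault 𝓗 X v)
      + C.dolbeault 𝓗 (C.P01 ⁅X, u.1⁆) v - C.dolbeault 𝓗 (C.P01 ⁅X, v.1⁆) u
      - C.proj10 (courantBracket 𝓗 (X, 0) (0, (courantBracket 𝓗 u v).2.comp C.P01)) := by
  have h := courantBracket_jacobi hc (X, 0) u v
  rw [courantBracket_vector_eq ht hX hu, courantBracket_vector_eq ht hX hv,
    courantBracket_eq_bracket10_add hu hv, courantBracket_add_right, courantBracket_add_right,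
    courantBracket_add_left,
    courantBracket_eq_neg_swap 𝓗 (pairing_vector_GT10 (C.P01_mem _) hu)] at h
  have h2 := congrArg C.proj10Linear h
  simp only [map_add, map_neg] at h2
  change C.dolbeault 𝓗 X (C.bracket10 𝓗 u v) + C.proj10 _ =
    (C.bracket10 𝓗 (C.dolbeault 𝓗 X u) v + C.dolbeault 𝓗 (C.P01 ⁅X, u.1⁆) v) +
    (C.bracket10 𝓗 u (C.dolbeault 𝓗 X v) + -C.dolbeault 𝓗 (C.P01 ⁅X, v.1⁆) u) at h2
  rw [eq_sub_of_add_eq h2]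
  abel

section Holomorphic

variable [FiniteDimensional ℝ E] [T2Space M] [IsManifold 𝓘(ℝ, E) ∞ M]

theorem isHolomorphicOn_bracket10 (hc : IsClosed3 𝓗)
    (ht : ∀ X ∈ C.T01, ∀ Y ∈ C.T01, ∀ Z, 𝓗 ![X, Y, Z] = 0) {U : Set M} (hU : IsOpen U)
    {u v : GT E M} (hu : u ∈ C.GT10) (hv : v ∈ C.GT10)
    (hDu : C.IsHolomorphicOn (C.dolbeault 𝓗) U u) (hDv : C.IsHolomorphicOn (C.dolbeault 𝓗) U v) :
    C.IsHolomorphicOn (C.dolbeault 𝓗) U (C.bracket10 𝓗 u v) := by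
  intro X hX x hx
  rw [dolbeault_bracket10 hc ht hX hu hv]
  refine VanishesAt.sub (VanishesAt.sub (VanishesAt.add (VanishesAt.add ?_ ?_) ?_) ?_) ?_
  · exact vanishesAt_map_of_isOpen hU (vanishesAt_courantBracket_left 𝓗 hU (hDu X hX) v)
      C.proj10Linear x hx
  · exact vanishesAt_map_of_isOpen hU (vanishesAt_courantBracket_right 𝓗 hU (hDv X hX) u)
      C.proj10Linear x hx
  · exact hDv _ (C.P01_mem _) x hx
  · exact hDu _ (C.P01_mem _) x hx
  -- The last correction involves only the (0,1)-part of the form in [u, v]. For W̃ = P01 W,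
  -- invariance of the pairing gives ⟨[u, v], W̃⟩ = ⟨D̄_W̃ u, v⟩, which vanishes on U because u is
  -- holomorphic there.
  · have key (W : VF E M) : (courantBracket 𝓗 u v).2 (C.P01 W) x = 0 := by
      have h := courantBracket_pairing 𝓗 u v (C.P01 W, 0)
      rw [pairing_vector, pairing_vector, (C.mem_GT10.mp hv).2 _ (C.P01_mem W), map_zero,
        courantBracket_eq_neg_swap 𝓗 (pairing_vector_GT10 (C.P01_mem W) hu), pairing_neg_right,
        pairing_comm v, ← pairing_proj10 hv, ← sub_eq_add_neg, eq_comm, sub_eq_zero] at h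
      rw [h, pairing_comm]
      exact pairing_eq_zero_of_isOpen hU (hDu _ (C.P01_mem W)) v x hx
    refine ⟨fun f => ?_, fun Z => ?_⟩
    · change C.P10 ⁅X, 0⁆ f x = 0
      rw [lie_zero, map_zero]; rfl
    · rw [proj10_snd_apply, courantBracket_snd_apply]
      simp only [LinearMap.comp_apply, C.P01_eq_zero (C.P10_mem Z), map_zero, zero_sub,
        form3_zero_left, LinearMap.zero_apply, sub_zero, add_zero]
      change -((courantBracket 𝓗 u v).2 (C.P01 ⁅X, C.P10 Z⁆) x) = 0
      rw [key, neg_zero]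

/-- The algebraic axioms are projections of those of the Courant bracket on 𝕋_ℂ M; the type
condition on `𝓗` makes what is projected away harmless. -/
theorem isHolomorphicCourantAlgebroid (hc : IsClosed3 𝓗)
    (ht : ∀ X ∈ C.T01, ∀ Y ∈ C.T01, ∀ Z, 𝓗 ![X, Y, Z] = 0) :
    C.IsHolomorphicCourantAlgebroid (C.dolbeault 𝓗) (C.bracket10 𝓗) where
  D_mem X _ u _ := C.proj10_mem _
  D_add X _ u _ v _ := by
    rw [dolbeault, courantBracket_add_right, proj10_add]; rfl
  D_leibniz X _ u hu f := by
    rw [dolbeault, courantBracket_smul_right, proj10_add, proj10_smul, proj10_smul,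
      C.proj10_eq_self hu]; rfl
  D_add_left X _ Y _ u _ := by
    rw [dolbeault, ← add_zero (0 : Form1 E M), ← Prod.mk_add_mk, courantBracket_add_left,
      proj10_add]; rfl
  D_smul_left X hX u hu f := by
    rw [dolbeault, ← smul_zero f, ← Prod.smul_mk, courantBracket_smul_left, pairing_comm,
      pairing_vector_GT10 hX hu, zero_smul, proj10_add, proj10_sub, proj10_smul, proj10_smul,
      C.proj10_vector hX, smul_zero, sub_zero]
    exact add_eq_left.mpr (map_zero C.proj10Linear)
  D_flat X hX Y hY u hu := by
    rw [proj10_courantBracket_dolbeault ht hX hY hu, proj10_courantBracket_dolbeault ht hY hX hu,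
      ← proj10_sub, courantBracket_jacobi hc, courantBracket_vector_vector ht hX hY,
      add_sub_cancel_right]
    rfl
  D_pairing X hX u hu v hv := by
    rw [pairing_comm u (dolbeault _ _ _ _), dolbeault, dolbeault, pairing_proj10 hv,
      pairing_proj10 hu, pairing_comm _ u]
    exact courantBracket_pairing 𝓗 (X, 0) u v
  D_anchor X _ u _ := rfl
  br_mem u _ v _ := C.proj10_mem _
  br_add u _ v _ w _ := by
    rw [bracket10, courantBracket_add_right, proj10_add]; rfl
  br_add_left u _ v _ w _ := by
    rw [bracket10, courantBracket_add_left, proj10_add]; rfl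
  br_leibniz u _ v hv f := by
    rw [bracket10, courantBracket_smul_right, proj10_add, proj10_smul, proj10_smul,
      C.proj10_eq_self hv]; rfl
  br_jacobi u hu v hv w hw := by
    rw [bracket10_bracket10 hu hv hw, bracket10_bracket10_left hu hv hw,
      bracket10_bracket10 hv hu hw, ← proj10_add, courantBracket_jacobi hc]
  br_anchor u hu v hv := C.P10_eq_self (C.lie_mem_T10 (C.mem_GT10.mp hu).1 (C.mem_GT10.mp hv).1)
  br_pairing u hu v hv w hw := by
    rw [pairing_comm v (bracket10 _ _ _ _), bracket10, bracket10, pairing_proj10 hw,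
      pairing_proj10 hv, pairing_comm _ v]
    exact courantBracket_pairing 𝓗 u v w
  br_symm u _ v _ := by
    rw [bracket10, bracket10, ← proj10_add, courantBracket_symm]
  br_holomorphic U hU u hu v hv hDu hDv := isHolomorphicOn_bracket10 hc ht hU hu hv hDu hDv

/-- Reduction of complementary Dirac structures: if `L₁` and `L₂` are Dirac structures with
`L₁ ∩ L₂ = T_{0,1} X`, whose sum is the orthogonal complement of `T_{0,1} X`, then they induce a
holomorphic Manin triple on `X`. -/
theorem isHolomorphicManinTriple_of_dirac (hc : IsClosed3 𝓗) {L₁ L₂ : Submodule (Fn E M) (GT E M)}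
    (hL₁ : IsLagrangianIn ⊤ L₁) (hL₂ : IsLagrangianIn ⊤ L₂)
    (hi₁ : ∀ u ∈ L₁, ∀ v ∈ L₁, courantBracket 𝓗 u v ∈ L₁)
    (hi₂ : ∀ u ∈ L₂, ∀ v ∈ L₂, courantBracket 𝓗 u v ∈ L₂)
    (hinf : L₁ ⊓ L₂ = C.T01.prod ⊥) (hsup : C.GT10 ≤ L₁ ⊔ L₂) :
    C.IsHolomorphicManinTriple 𝓗 (C.GT10 ⊓ L₁) (C.GT10 ⊓ L₂) := by
  have hT {X : VF E M} (hX : X ∈ C.T01) : ((X, 0) : GT E M) ∈ L₁ ⊓ L₂ := by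
    rw [hinf]; exact ⟨hX, rfl⟩
  -- The bracket of two (0,1)-vectors lies in both Dirac structures, hence in T_{0,1}, so its form
  -- part, a contraction of `𝓗`, is zero.
  have ht : ∀ X ∈ C.T01, ∀ Y ∈ C.T01, ∀ Z, 𝓗 ![X, Y, Z] = 0 := by
    intro X hX Y hY Z
    have h : courantBracket 𝓗 (Y, 0) (X, 0) ∈ L₁ ⊓ L₂ :=
      ⟨hi₁ _ (hT hY).1 _ (hT hX).1, hi₂ _ (hT hY).2 _ (hT hX).2⟩
    rw [hinf] at h
    have h2 : (courantBracket 𝓗 (Y, 0) (X, 0)).2 = 0 := h.2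
    have h3 := courantBracket_snd_apply 𝓗 (Y, 0) (X, 0) Z
    rw [h2] at h3
    simpa using h3.symm
  -- A Lagrangian L containing T_{0,1} lies in the complement orthogonal to T_{0,1}, so projecting a
  -- section of L subtracts only a section of T_{0,1} and stays in L.
  have hproj {L : Submodule (Fn E M) (GT E M)} (hL : IsLagrangianIn ⊤ L)
      (hTL : ∀ X ∈ C.T01, ((X, 0) : GT E M) ∈ L) {u : GT E M} (hu : u ∈ L) :
      C.proj10 u ∈ C.GT10 ⊓ L := by
    refine ⟨C.proj10_mem u, ?_⟩
    have h := C.eq_proj10_add (u := u) fun Y hY => by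
      rw [← pairing_vector]; exact (hL.2 u trivial).mp hu _ (hTL Y hY)
    rw [eq_sub_of_add_eq h.symm]
    exact L.sub_mem hu (hTL _ (C.P01_mem _))
  have hdisj : C.GT10 ⊓ L₁ ⊓ (C.GT10 ⊓ L₂) = ⊥ := by
    rw [eq_bot_iff]
    rintro u ⟨⟨hu, hu₁⟩, ⟨-, hu₂⟩⟩
    have h : u ∈ L₁ ⊓ L₂ := ⟨hu₁, hu₂⟩
    rw [hinf] at h
    rw [Submodule.mem_bot, ← C.proj10_eq_self hu,
      show u = (u.1, 0) from Prod.ext rfl h.2, C.proj10_vector h.1]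
  have hspan : C.GT10 ⊓ L₁ ⊔ C.GT10 ⊓ L₂ = C.GT10 := by
    refine le_antisymm (sup_le inf_le_left inf_le_left) fun u hu => ?_
    obtain ⟨a, ha, b, hb, hab⟩ := Submodule.mem_sup.mp (hsup hu)
    refine Submodule.mem_sup.mpr ⟨_, hproj hL₁ (fun X hX => (hT hX).1) ha, _,
      hproj hL₂ (fun X hX => (hT hX).2) hb, ?_⟩
    rw [← proj10_add, hab, C.proj10_eq_self hu]
  have hdirac {L N : Submodule (Fn E M) (GT E M)} (hL : IsLagrangianIn ⊤ L)
      (hi : ∀ u ∈ L, ∀ v ∈ L, courantBracket 𝓗 u v ∈ L)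
      (hTL : ∀ X ∈ C.T01, ((X, 0) : GT E M) ∈ L) (hN : C.GT10 ⊓ L ⊓ N = ⊥)
      (hN' : C.GT10 ⊓ L ⊔ N = C.GT10) :
      C.IsHolomorphicDirac (C.dolbeault 𝓗) (C.bracket10 𝓗) (C.GT10 ⊓ L) := by
    refine ⟨⟨N, hN, hN'⟩, ⟨inf_le_left, fun u hu => ⟨fun h v hv => ?_, fun h => ⟨hu, ?_⟩⟩⟩,
      fun X hX u hu => hproj hL hTL (hi _ (hTL X hX) _ hu.2),
      fun u hu v hv => hproj hL hTL (hi _ hu.2 _ hv.2)⟩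
    · exact (hL.2 u trivial).mp h.2 v hv.2
    -- A general v in L may be replaced by its projection, because u in 𝕋_{1,0} pairs equally with
    -- both.
    · refine (hL.2 u trivial).mpr fun v hv => ?_
      rw [pairing_comm, ← pairing_proj10 hu, pairing_comm]
      exact h _ (hproj hL hTL hv)
  exact ⟨hc, ht, isHolomorphicCourantAlgebroid hc ht,
    hdirac hL₁ hi₁ (fun X hX => (hT hX).1) hdisj hspan,
    hdirac hL₂ hi₂ (fun X hX => (hT hX).2) (by rwa [inf_comm]) (by rwa [sup_comm]), hdisj, hspan⟩

end Holomorphic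

end ComplexStructure

/-! ### Generalized complex structures -/

theorem cI_smul_cI_GT (u : GT E M) : (cI : Fn E M) • (cI : Fn E M) • u = -u := cI_smul_cI u

theorem neg_smul_GT (f : Fn E M) (u : GT E M) : (-f) • u = -(f • u) := neg_smul f u

theorem mem_eigenbundle {J : GT E M →ₗ[Fn E M] GT E M} {u : GT E M} :
    u ∈ eigenbundle J ↔ J u = (cI : Fn E M) • u := Module.End.mem_eigenspace_iff

namespace IsGeneralizedComplex

variable {H : Form 3 E M} {J : GT E M →ₗ[Fn E M] GT E M}

theorem mem_conjSub_eigenbundle (h : IsGeneralizedComplex H J) {u : GT E M} :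
    u ∈ conjSub (eigenbundle J) ↔ J u = -((cI : Fn E M) • u) := by
  rw [mem_conjSub, mem_eigenbundle, h.real, ← conjGT_injective.eq_iff, conjGT_conjGT, conjGT_smul,
    conjGT_conjGT, conjFn_cI, neg_smul_GT]

theorem sub_mem (h : IsGeneralizedComplex H J) (u : GT E M) :
    u - (cI : Fn E M) • J u ∈ eigenbundle J := by
  rw [mem_eigenbundle, map_sub, map_smul, h.sq, smul_sub, cI_smul_cI_GT, smul_neg, sub_neg_eq_add,
    sub_neg_eq_add, add_comm]

theorem add_mem (h : IsGeneralizedComplex H J) (u : GT E M) :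
    u + (cI : Fn E M) • J u ∈ conjSub (eigenbundle J) := by
  rw [h.mem_conjSub_eigenbundle, map_add, map_smul, h.sq, smul_add, cI_smul_cI_GT, smul_neg]
  abel

/-- Isotropy of L applied to (1 - iJ)u, (1 - iJ)v and of L̄ applied to (1 + iJ)u, (1 + iJ)v gives
two identities; in their sum the terms with one J cancel. -/
theorem pairing_map (h : IsGeneralizedComplex H J) (u v : GT E M) :
    pairing (J u) (J v) = pairing u v := by
  have h₁ := (h.lagrangian.2 _ trivial).mp (h.sub_mem u) _ (h.sub_mem v)
  have h₂ := (h.lagrangian.conjSub.2 _ trivial).mp (h.add_mem u) _ (h.add_mem v)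
  simp only [pairing_sub_left, pairing_sub_right, pairing_add_left, pairing_add_right,
    pairing_smul_left, pairing_smul_right] at h₁ h₂
  refine eq_of_two_mul_eq ?_
  linear_combination -h₁ - h₂ + 2 * pairing (J u) (J v) * cI_mul_cI (E := E) (M := M)

theorem pairing_skew (h : IsGeneralizedComplex H J) (u v : GT E M) :
    pairing (J u) v = -pairing u (J v) := by
  rw [← h.pairing_map u (J v), h.sq, pairing_neg_right, neg_neg]

theorem eigenbundle_neg (h : IsGeneralizedComplex H J) :
    eigenbundle (-J) = conjSub (eigenbundle J) := by
  ext u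
  rw [h.mem_conjSub_eigenbundle, mem_eigenbundle, LinearMap.neg_apply, neg_eq_iff_eq_neg]

theorem neg (h : IsGeneralizedComplex H J) (hH : IsRealForm H) :
    IsGeneralizedComplex H (-J) where
  real u := by rw [LinearMap.neg_apply, LinearMap.neg_apply, h.real, conjGT_neg]
  sq u := by rw [LinearMap.neg_apply, LinearMap.neg_apply, map_neg, neg_neg, h.sq]
  lagrangian := by
    rw [h.eigenbundle_neg]; exact h.lagrangian.conjSub
  involutive := by
    rw [h.eigenbundle_neg]; exact involutive_conjSub hH h.involutive

theorem conjSub_eigenbundle_neg (h : IsGeneralizedComplex H J) :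
    conjSub (eigenbundle (-J)) = eigenbundle J := by
  ext u
  rw [h.eigenbundle_neg, mem_conjSub, mem_conjSub, conjGT_conjGT]

end IsGeneralizedComplex

/-! ### The metric -/

/-- Commuting generalized complex structures `J`, `J'` for which `J J'` is, up to sign, the
reflection that exchanges `X` and `k X`. -/
structure IsCompatiblePair (H : Form 3 E M) (J J' : GT E M →ₗ[Fn E M] GT E M)
    (k : VF E M ≃ₗ[Fn E M] Form1 E M) : Prop where
  genA : IsGeneralizedComplex H J
  genB : IsGeneralizedComplex H J'
  comm : ∀ u, J (J' u) = J' (J u)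
  apply_mk : ∀ X α, J (J' (X, α)) = (-(k.symm α), -(k X))

namespace IsGeneralizedKahler

variable {H : Form 3 E M} {JA JB : GT E M →ₗ[Fn E M] GT E M}

theorem map_map_map_map (h : IsGeneralizedKahler H JA JB) (u : GT E M) :
    JA (JB (JA (JB u))) = u := by
  rw [← h.comm, h.genA.sq, h.genB.sq, neg_neg]

/-- The map `X ↦ -J_A J_B X` from vector fields to 1-forms. -/
noncomputable def metricMap (JA JB : GT E M →ₗ[Fn E M] GT E M) : VF E M →ₗ[Fn E M] Form1 E M :=
  -(LinearMap.snd (Fn E M) (VF E M) (Form1 E M) ∘ₗ JA ∘ₗ JB ∘ₗ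
    LinearMap.inl (Fn E M) (VF E M) (Form1 E M))

theorem map_map_vector (hs : ∀ X : VF E M, (JA (JB (X, 0))).1 = 0) (X : VF E M) :
    JA (JB (X, 0)) = (0, -metricMap JA JB X) :=
  Prod.ext (hs X) (neg_neg (JA (JB (X, 0))).2).symm

theorem map_map_form (h : IsGeneralizedKahler H JA JB)
    (hs : ∀ X : VF E M, (JA (JB (X, 0))).1 = 0) (X : VF E M) :
    JA (JB (0, metricMap JA JB X)) = (-X, 0) := by
  have h1 := congrArg (fun u => -JA (JB u)) (map_map_vector hs X)
  simp only [h.map_map_map_map] at h1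
  rw [← map_neg, ← map_neg] at h1
  simpa using h1.symm

/-- For a real form δ the hypothesis says that J_A J_B δ is a form, so ⟨J_A δ, J_B δ⟩ = -⟨δ, J_A J_B
δ⟩ = 0, against positivity unless δ = 0. A complex γ is handled through real forms: γ + γ̄ vanishes
first, and then iγ is real. -/
theorem form_eq_zero (h : IsGeneralizedKahler H JA JB) {γ : Form1 E M}
    (hγ : (JA (JB (0, γ))).1 = 0) : γ = 0 := by
  have hreal {δ : Form1 E M} (hδ : (JA (JB (0, δ))).1 = 0) (hc : conjForm1 δ = δ) : δ = 0 := by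
    have h0 : ((0, δ) : GT E M) = 0 := by
      refine eq_zero_of_vanishesAt fun x => ?_
      by_contra hx
      have hpos := h.pos (0, δ) (Prod.ext conjVF_zero hc) x hx
      rw [h.genA.pairing_skew] at hpos
      have : pairing (0, δ) (JA (JB (0, δ))) = 0 := by
        simp [pairing, hδ]
      rw [this, neg_zero] at hpos
      exact lt_irrefl _ hpos
    exact congrArg Prod.snd h0
  have hconj : (JA (JB (0, conjForm1 γ))).1 = 0 := by
    rw [show ((0, conjForm1 γ) : GT E M) = conjGT (0, γ) from Prod.ext conjVF_zero.symm rfl,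
      h.genB.real, h.genA.real]
    change conjVF _ = 0
    rw [hγ, conjVF_zero]
  have h1 : γ + conjForm1 γ = 0 := by
    refine hreal ?_ ?_
    · rw [show ((0, γ + conjForm1 γ) : GT E M) = (0, γ) + (0, conjForm1 γ) by simp, map_add,
        map_add, Prod.fst_add, hγ, hconj, add_zero]
    · have h2 := congrArg Prod.snd (conjGT_add (0, γ) (0, conjForm1 γ))
      refine Eq.trans ?_ (h2.trans ?_)
      · rfl
      · change conjForm1 γ + conjForm1 (conjForm1 γ) = _
        rw [conjForm1_conjForm1, add_comm]
  have h2 : (cI : Fn E M) • γ = 0 := by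
    refine hreal ?_ ?_
    · rw [show ((0, (cI : Fn E M) • γ) : GT E M) = (cI : Fn E M) • (0, γ) by simp, map_smul,
        map_smul, Prod.smul_fst, hγ, smul_zero]
    · refine (congrArg Prod.snd (conjGT_smul cI ((0, γ) : GT E M))).trans ?_
      change conjFn cI • conjForm1 γ = _
      rw [eq_neg_of_add_eq_zero_right h1, conjFn_cI, smul_neg, neg_smul, neg_neg]
  rw [← neg_eq_zero, ← cI_smul_cI (E := E) (M := M), h2, smul_zero]

/-- Injectivity is (J_A J_B)² = 1. For surjectivity the candidate preimage of α is minus the vector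
part of J_A J_B α; the error is a form sent to a form, hence zero by `form_eq_zero`. -/
theorem metricMap_bijective (h : IsGeneralizedKahler H JA JB)
    (hs : ∀ X : VF E M, (JA (JB (X, 0))).1 = 0) : Function.Bijective (metricMap JA JB) := by
  constructor
  · rw [← LinearMap.ker_eq_bot, LinearMap.ker_eq_bot']
    intro X hX
    have h1 := h.map_map_form hs X
    rw [hX, show ((0, 0) : GT E M) = 0 from rfl, map_zero, map_zero] at h1
    exact neg_eq_zero.mp (congrArg Prod.fst h1).symm
  · intro α
    refine ⟨-(JA (JB (0, α))).1, ?_⟩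
    have h1 : metricMap JA JB (-(JA (JB (0, α))).1) - α = 0 := by
      refine h.form_eq_zero ?_
      rw [show ((0, metricMap JA JB (-(JA (JB (0, α))).1) - α) : GT E M) =
        (0, metricMap JA JB (-(JA (JB (0, α))).1)) - (0, α) by simp, map_sub, map_sub,
        h.map_map_form hs, Prod.fst_sub, neg_neg, sub_self]
    exact sub_eq_zero.mp h1

/-- The Riemannian metric of a generalized Kähler structure. -/
noncomputable def metric (h : IsGeneralizedKahler H JA JB)
    (hs : ∀ X : VF E M, (JA (JB (X, 0))).1 = 0) : VF E M ≃ₗ[Fn E M] Form1 E M :=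
  LinearEquiv.ofBijective (metricMap JA JB) (h.metricMap_bijective hs)

theorem isCompatiblePair (h : IsGeneralizedKahler H JA JB)
    (hs : ∀ X : VF E M, (JA (JB (X, 0))).1 = 0) : IsCompatiblePair H JA JB (h.metric hs) where
  genA := h.genA
  genB := h.genB
  comm := h.comm
  apply_mk X α := by
    have h1 := h.map_map_form hs ((h.metric hs).symm α)
    rw [show metricMap JA JB ((h.metric hs).symm α) = α from (h.metric hs).apply_symm_apply α] at h1
    rw [show ((X, α) : GT E M) = (X, 0) + (0, α) by simp, map_add, map_add, h1,
      map_map_vector hs]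
    simp [metric]

end IsGeneralizedKahler

namespace IsCompatiblePair

variable {H : Form 3 E M} {J J' : GT E M →ₗ[Fn E M] GT E M} {k : VF E M ≃ₗ[Fn E M] Form1 E M}

/-- This symmetry reduces the minus side to the plus side: applied to (J_A, J_B, g) it yields a pair
whose graph is that of -g and whose complex structure is I_-. -/
theorem neg (h : IsCompatiblePair H J J' k) (hH : IsRealForm H) :
    IsCompatiblePair H J (-J') ((LinearEquiv.neg (Fn E M)).trans k) where
  genA := h.genA
  genB := h.genB.neg hH
  comm u := by rw [LinearMap.neg_apply, LinearMap.neg_apply, map_neg, h.comm]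
  apply_mk X α := by
    rw [LinearMap.neg_apply, map_neg, h.apply_mk]
    refine Prod.ext ?_ ?_
    · rfl
    · change - -(k X) = -(k (-X))
      rw [map_neg]

theorem metric_symm (h : IsCompatiblePair H J J' k) (X Y : VF E M) : k X Y = k Y X := by
  have h1 : pairing (J (J' (X, 0))) (Y, 0) = pairing (X, 0) (J (J' (Y, 0))) := by
    rw [h.genA.pairing_skew, h.genB.pairing_skew, neg_neg, h.comm]
  rw [h.apply_mk, h.apply_mk] at h1
  simpa [pairing] using h1

theorem metric_conjVF (h : IsCompatiblePair H J J' k) (X : VF E M) :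
    k (conjVF X) = conjForm1 (k X) := by
  have h1 := congrArg J (h.genB.real (X, 0))
  rw [h.genA.real, h.apply_mk,
    show conjGT ((X, 0) : GT E M) = (conjVF X, 0) from Prod.ext rfl conjForm1_zero,
    h.apply_mk] at h1
  have h2 : -(k (conjVF X)) = conjForm1 (-(k X)) := congrArg Prod.snd h1
  rwa [conjForm1_neg, neg_inj] at h2

theorem map_map_eq_neg_iff (h : IsCompatiblePair H J J' k) {u : GT E M} :
    J (J' u) = -u ↔ u.2 = k u.1 := by
  obtain ⟨X, α⟩ := u
  rw [h.apply_mk]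
  constructor
  · intro h1
    exact (neg_inj.mp (congrArg Prod.snd h1)).symm
  · rintro (rfl : α = k X)
    change (-(k.symm (k X)), -(k X)) = (-X, -(k X))
    rw [k.symm_apply_apply]

/-- The endomorphism `I` of `T_ℂ M` with `J (X + k X) = I X + k I X`. -/
noncomputable def graphMap (J : GT E M →ₗ[Fn E M] GT E M) (k : VF E M ≃ₗ[Fn E M] Form1 E M) :
    VF E M →ₗ[Fn E M] VF E M :=
  LinearMap.fst (Fn E M) (VF E M) (Form1 E M) ∘ₗ J ∘ₗ LinearMap.id.prod k.toLinearMap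

/-- The graph of `k` is the -1 eigenbundle of `J J'`, and `J` commutes with that product. -/
theorem map_graph (h : IsCompatiblePair H J J' k) (X : VF E M) :
    J (X, k X) = (graphMap J k X, k (graphMap J k X)) := by
  have h1 : J (J' (J (X, k X))) = -J (X, k X) := by
    rw [← h.comm, h.map_map_eq_neg_iff.mpr rfl, map_neg]
  exact Prod.ext rfl (h.map_map_eq_neg_iff.mp h1)

theorem map_graph' (h : IsCompatiblePair H J J' k) (X : VF E M) :
    J' (X, k X) = J (X, k X) := by
  have h1 : J (J' (X, k X)) = -(X, k X) := h.map_map_eq_neg_iff.mpr rfl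
  have h2 := congrArg J h1
  rwa [h.genA.sq, map_neg, neg_inj] at h2

theorem graph_injective {X Y : VF E M} (h : ((X, k X) : GT E M) = (Y, k Y)) : X = Y :=
  congrArg Prod.fst h

theorem graph_smul (f : Fn E M) (X : VF E M) : f • ((X, k X) : GT E M) = (f • X, k (f • X)) := by
  rw [map_smul]; rfl

/-- On the intersection of the +i eigenbundles `J J'` is i · i = -1, which forces the section into
the graph of `k`. -/
theorem mem_inf_iff (h : IsCompatiblePair H J J' k) {u : GT E M} :
    u ∈ eigenbundle J ⊓ eigenbundle J' ↔
      u.2 = k u.1 ∧ graphMap J k u.1 = (cI : Fn E M) • u.1 := by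
  obtain ⟨X, α⟩ := u
  rw [Submodule.mem_inf, mem_eigenbundle, mem_eigenbundle]
  constructor
  · rintro ⟨h1, h2⟩
    obtain rfl : α = k X := h.map_map_eq_neg_iff.mp (by rw [h2, map_smul, h1, cI_smul_cI_GT])
    exact ⟨rfl, by rw [h.map_graph] at h1; exact congrArg Prod.fst h1⟩
  · rintro ⟨rfl : α = k X, h2 : graphMap J k X = _⟩
    rw [h.map_graph', h.map_graph, h2, graph_smul]
    exact ⟨rfl, rfl⟩

theorem mem_conjSub_inf_iff (h : IsCompatiblePair H J J' k) {u : GT E M} :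
    u ∈ conjSub (eigenbundle J) ⊓ conjSub (eigenbundle J') ↔
      u.2 = k u.1 ∧ graphMap J k u.1 = -((cI : Fn E M) • u.1) := by
  obtain ⟨X, α⟩ := u
  rw [Submodule.mem_inf, h.genA.mem_conjSub_eigenbundle, h.genB.mem_conjSub_eigenbundle]
  constructor
  · rintro ⟨h1, h2⟩
    obtain rfl : α = k X := h.map_map_eq_neg_iff.mp
      (by rw [h2, map_neg, map_smul, h1, smul_neg, neg_neg, cI_smul_cI_GT])
    exact ⟨rfl, by rw [h.map_graph] at h1; exact congrArg Prod.fst h1⟩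
  · rintro ⟨rfl : α = k X, h2 : graphMap J k X = _⟩
    rw [h.map_graph', h.map_graph, h2, ← neg_smul, ← neg_smul_GT, graph_smul]
    exact ⟨rfl, rfl⟩

/-- The complex structure `I` on `M` with `J (X + k X) = I X + k I X`. -/
noncomputable def complexStructure (h : IsCompatiblePair H J J' k) : ComplexStructure E M where
  I := graphMap J k
  real X := by
    refine graph_injective (k := k) ?_
    rw [← h.map_graph, h.metric_conjVF, h.metric_conjVF]
    refine (h.genA.real (X, k X)).trans ?_
    rw [h.map_graph]; rfl
  sq X := by
    refine graph_injective (k := k) ?_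
    rw [← h.map_graph, ← h.map_graph, h.genA.sq, map_neg]; rfl
  integrable X hX Y hY := by
    rw [Module.End.mem_eigenspace_iff] at hX hY ⊢
    have hX' : ((X, k X) : GT E M) ∈ eigenbundle J ⊓ eigenbundle J' := h.mem_inf_iff.mpr ⟨rfl, hX⟩
    have hY' : ((Y, k Y) : GT E M) ∈ eigenbundle J ⊓ eigenbundle J' := h.mem_inf_iff.mpr ⟨rfl, hY⟩
    exact (h.mem_inf_iff.mp ⟨h.genA.involutive _ hX'.1 _ hY'.1,
      h.genB.involutive _ hX'.2 _ hY'.2⟩).2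

/-- The pairing restricts to 2k on the graph, and `J` preserves the pairing. -/
theorem orthogonal (h : IsCompatiblePair H J J' k) (X Y : VF E M) :
    k (h.complexStructure.I X) (h.complexStructure.I Y) = k X Y := by
  have h1 := h.genA.pairing_map (X, k X) (Y, k Y)
  rw [h.map_graph, h.map_graph] at h1
  change k (h.complexStructure.I Y) (h.complexStructure.I X) +
    k (h.complexStructure.I X) (h.complexStructure.I Y) = k Y X + k X Y at h1
  rw [h.metric_symm (h.complexStructure.I Y), h.metric_symm Y, ← two_mul, ← two_mul] at h1
  exact eq_of_two_mul_eq h1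

/-- The Hermitian form `k I`. -/
noncomputable def form (h : IsCompatiblePair H J J' k) : Form 2 E M :=
  BiHermitian.hermForm k h.metric_symm h.complexStructure h.orthogonal

theorem form_apply (h : IsCompatiblePair H J J' k) (X Y : VF E M) :
    h.form ![X, Y] = k (h.complexStructure.I X) Y := rfl

theorem map_apply (h : IsCompatiblePair H J J' k) (X : VF E M) :
    J (X, k X) = (h.complexStructure.I X, k (h.complexStructure.I X)) := h.map_graph X

theorem map_apply' (h : IsCompatiblePair H J J' k) (X : VF E M) :
    J' (X, k X) = (h.complexStructure.I X, k (h.complexStructure.I X)) :=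
  (h.map_graph' X).trans (h.map_graph X)

/-! ### The Manin triple -/

/-- The intersection of the conjugate eigenbundles consists of X + kX with IX = -iX. For such X the
form kI contracts to -ikX, so the gauge transformation by -i times it adds -kX and leaves X alone.
-/
theorem inf_map_gauge (h : IsCompatiblePair H J J' k) :
    (conjSub (eigenbundle J)).map (gauge (-Complex.I • h.form)) ⊓
      (conjSub (eigenbundle J')).map (gauge (-Complex.I • h.form)) =
        h.complexStructure.T01.prod ⊥ := by
  ext u
  have h1 : u ∈ (conjSub (eigenbundle J)).map (gauge (-Complex.I • h.form)) ⊓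
      (conjSub (eigenbundle J')).map (gauge (-Complex.I • h.form)) ↔
      gauge (-(-Complex.I • h.form)) u ∈ conjSub (eigenbundle J) ⊓ conjSub (eigenbundle J') := by
    rw [Submodule.mem_inf, mem_map_gauge, mem_map_gauge, Submodule.mem_inf]
  rw [h1, h.mem_conjSub_inf_iff, gauge_fst]
  have h2 (Z : VF E M) (hu : h.complexStructure.I u.1 = -((cI : Fn E M) • u.1)) :
      (gauge (-(-Complex.I • h.form)) u).2 Z = u.2 Z + k u.1 Z := by
    rw [gauge_snd_apply, AlternatingMap.neg_apply, AlternatingMap.smul_apply, form_apply, hu,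
      map_neg, map_smul, smul_eq_algebraMap_mul, map_neg]
    change u.2 Z + -(-cI * -(cI * k u.1 Z)) = _
    linear_combination -(k u.1 Z) * cI_mul_cI (E := E) (M := M)
  rw [Submodule.mem_prod, ComplexStructure.mem_T01, Submodule.mem_bot, and_comm]
  refine and_congr_right fun hu => ?_
  constructor
  · intro h3
    ext1 Z
    have h4 := LinearMap.congr_fun h3 Z
    rw [h2 Z hu] at h4
    exact add_eq_right.mp h4
  · intro h3
    ext1 Z
    rw [h2 Z hu, h3, LinearMap.zero_apply, zero_add]

/-- This is (L̄ ∩ L̄')^⊥ ⊆ L̄ + L̄', obtained from explicit projections instead of a dimension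
count. Skewness moves (1 - iJ')(1 - iJ) from w onto v as (1 + iJ')(1 + iJ)v, a section of the
intersection, so (1 - iJ')(1 - iJ)w = 0. Then w = ½(1 + iJ)w + ¼(1 + iJ')(1 - iJ)w. -/
theorem mem_sup_of_pairing (h : IsCompatiblePair H J J' k) {w : GT E M}
    (hw : ∀ v ∈ conjSub (eigenbundle J) ⊓ conjSub (eigenbundle J'), pairing w v = 0) :
    w ∈ conjSub (eigenbundle J) ⊔ conjSub (eigenbundle J') := by
  have hc : w - (cI : Fn E M) • J w - (cI : Fn E M) • J' (w - (cI : Fn E M) • J w) = 0 := by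
    refine eq_zero_of_pairing_eq_zero fun v => ?_
    have h2 : v + (cI : Fn E M) • J v + (cI : Fn E M) • J' (v + (cI : Fn E M) • J v) =
        v + (cI : Fn E M) • J' v + (cI : Fn E M) • J (v + (cI : Fn E M) • J' v) := by
      simp only [map_add, map_smul, h.comm, smul_add]
      abel
    have h1 := hw (v + (cI : Fn E M) • J v + (cI : Fn E M) • J' (v + (cI : Fn E M) • J v))
      ⟨by rw [h2]; exact h.genA.add_mem _, h.genB.add_mem _⟩
    rw [← h1]
    simp only [map_add, map_sub, map_smul, pairing_add_right, pairing_sub_left, pairing_smul_left,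
      pairing_smul_right, h.genA.pairing_skew, h.genB.pairing_skew, h.comm]
    ring
  have hw2 : w = algebraMap ℂ (Fn E M) (1 / 2) • (w + (cI : Fn E M) • J w) +
      algebraMap ℂ (Fn E M) (1 / 2) • algebraMap ℂ (Fn E M) (1 / 2) •
        (w - (cI : Fn E M) • J w + (cI : Fn E M) • J' (w - (cI : Fn E M) • J w)) := by
    rw [← sub_eq_zero.mp hc, ← two_smul (Fn E M) (w - (cI : Fn E M) • J w),
      smul_smul _ (2 : Fn E M), mul_comm, two_mul_half, one_smul, ← smul_add]
    refine eq_of_two_smul_eq (E := E) (M := M) ?_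
    rw [smul_smul, two_mul_half, one_smul, two_smul]
    abel
  rw [hw2]
  exact Submodule.add_mem_sup (Submodule.smul_mem _ _ (h.genA.add_mem w))
    (Submodule.smul_mem _ _ (Submodule.smul_mem _ _ (h.genB.add_mem _)))

theorem GT10_le_sup (h : IsCompatiblePair H J J' k) :
    h.complexStructure.GT10 ≤ (conjSub (eigenbundle J)).map (gauge (-Complex.I • h.form)) ⊔
      (conjSub (eigenbundle J')).map (gauge (-Complex.I • h.form)) := by
  intro u hu
  rw [← Submodule.map_sup, mem_map_gauge]
  refine h.mem_sup_of_pairing fun v hv => ?_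
  rw [← pairing_gauge (-Complex.I • h.form), gauge_gauge_neg]
  have hv2 : gauge (-Complex.I • h.form) v ∈ h.complexStructure.T01.prod ⊥ := by
    rw [← h.inf_map_gauge]
    exact ⟨⟨v, hv.1, rfl⟩, ⟨v, hv.2, rfl⟩⟩
  rw [show gauge (-Complex.I • h.form) v = (v.1, 0) from Prod.ext rfl hv2.2]
  exact ComplexStructure.pairing_vector_GT10 hv2.1 hu

theorem isHolomorphicManinTriple [FiniteDimensional ℝ E] [T2Space M] [IsManifold 𝓘(ℝ, E) ∞ M]
    (h : IsCompatiblePair H J J' k) (hH : IsRealForm H) (hc : IsClosed3 H) :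
    h.complexStructure.IsHolomorphicManinTriple (H + d2 (-Complex.I • h.form))
      (h.complexStructure.GT10 ⊓ (conjSub (eigenbundle J)).map (gauge (-Complex.I • h.form)))
      (h.complexStructure.GT10 ⊓ (conjSub (eigenbundle J')).map (gauge (-Complex.I • h.form))) :=
  ComplexStructure.isHolomorphicManinTriple_of_dirac (hc.add (isClosed3_d2 _))
    (h.genA.lagrangian.conjSub.map_gauge _) (h.genB.lagrangian.conjSub.map_gauge _)
    (involutive_map_gauge _ (involutive_conjSub hH h.genA.involutive))
    (involutive_map_gauge _ (involutive_conjSub hH h.genB.involutive))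
    h.inf_map_gauge h.GT10_le_sup

end IsCompatiblePair

/-! ### The torsion of the Hermitian forms -/

theorem d2_smul (c : ℂ) (B : Form 2 E M) : d2 (c • B) = c • d2 B := by
  ext v
  obtain ⟨X, Y, Z, rfl⟩ : ∃ X Y Z, v = ![X, Y, Z] :=
    ⟨v 0, v 1, v 2, by ext1 m; fin_cases m <;> rfl⟩
  simp only [d2_apply, AlternatingMap.smul_apply, Derivation.map_smul, smul_sub, smul_add]

theorem d2_neg (B : Form 2 E M) : d2 (-B) = -d2 B := by
  ext v
  obtain ⟨X, Y, Z, rfl⟩ : ∃ X Y Z, v = ![X, Y, Z] :=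
    ⟨v 0, v 1, v 2, by ext1 m; fin_cases m <;> rfl⟩
  simp only [d2_apply, AlternatingMap.neg_apply, map_neg]
  ring_nf

theorem smul_neg_form {n : ℕ} (c : ℂ) (η : Form n E M) : c • -η = (-c) • η := by
  ext1 v
  change c • -η v = (-c) • η v
  rw [smul_neg, neg_smul]

theorem d2_conjVF {B : Form 2 E M} (hB : IsRealForm B) (X Y Z : VF E M) :
    d2 B ![conjVF X, conjVF Y, conjVF Z] = conjFn (d2 B ![X, Y, Z]) := by
  simp only [d2_apply, ← conjVF_lie, hB.apply_two, conjVF_apply, conjFn_conjFn, conjFn_sub,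
    conjFn_add]

theorem form3_ext {η ξ : Form 3 E M} (h : ∀ X Y Z, η ![X, Y, Z] = ξ ![X, Y, Z]) : η = ξ := by
  ext1 v
  rw [show v = ![v 0, v 1, v 2] by ext1 m; fin_cases m <;> rfl]
  exact h _ _ _

theorem mixed_apply (P Q : VF E M →ₗ[Fn E M] VF E M) (η : Form 3 E M) (X Y Z : VF E M) :
    ComplexStructure.mixed P Q η ![X, Y, Z] =
      η ![Q X, P Y, P Z] + η ![P X, Q Y, P Z] + η ![P X, P Y, Q Z] :=
  ComplexStructure.mixedMultilinear_apply P Q η ![X, Y, Z]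

namespace ComplexStructure

variable {C : ComplexStructure E M} {H : Form 3 E M} {φ : Form 2 E M}

theorem del_apply (X Y Z : VF E M) : C.del φ ![X, Y, Z] =
    d2 φ ![C.P01 X, C.P10 Y, C.P10 Z] + d2 φ ![C.P10 X, C.P01 Y, C.P10 Z]
      + d2 φ ![C.P10 X, C.P10 Y, C.P01 Z] := mixed_apply _ _ _ _ _ _

theorem delbar_apply (X Y Z : VF E M) : C.delbar φ ![X, Y, Z] =
    d2 φ ![C.P10 X, C.P01 Y, C.P01 Z] + d2 φ ![C.P01 X, C.P10 Y, C.P01 Z]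
      + d2 φ ![C.P01 X, C.P01 Y, C.P10 Z] := mixed_apply _ _ _ _ _ _

theorem form3_split (η : Form 3 E M) (X Y Z : VF E M) : η ![X, Y, Z] =
    η ![C.P10 X, C.P10 Y, C.P10 Z] + η ![C.P01 X, C.P10 Y, C.P10 Z]
      + η ![C.P10 X, C.P01 Y, C.P10 Z] + η ![C.P10 X, C.P10 Y, C.P01 Z]
      + η ![C.P10 X, C.P01 Y, C.P01 Z] + η ![C.P01 X, C.P10 Y, C.P01 Z]
      + η ![C.P01 X, C.P01 Y, C.P10 Z] + η ![C.P01 X, C.P01 Y, C.P01 Z] := by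
  conv_lhs => rw [← C.P10_add_P01 X, ← C.P10_add_P01 Y, ← C.P10_add_P01 Z]
  simp only [form3_add_left, form3_add_mid, form3_add_right]
  ring

/-- If `φ` is a real form of type `(1,1)` and the `(1,2)`- and `(0,3)`-components of `H - i dφ`
vanish, for a real 3-form `H`, then `d^c φ = H` and `-2i ∂φ = H - i dφ`. -/
theorem dc_eq_and_del_eq (hH : IsRealForm H) (hφ : IsRealForm φ)
    (hφ0 : ∀ X ∈ C.T10, ∀ Y ∈ C.T10, φ ![X, Y] = 0)
    (ht : ∀ X ∈ C.T01, ∀ Y ∈ C.T01, ∀ Z, (H + d2 (-Complex.I • φ)) ![X, Y, Z] = 0) :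
    C.dc φ = H ∧ (-2 * Complex.I) • C.del φ = H + d2 (-Complex.I • φ) := by
  have hs (X Y Z : VF E M) : (H + d2 (-Complex.I • φ)) ![X, Y, Z] =
      H ![X, Y, Z] - cI * d2 φ ![X, Y, Z] := by
    rw [d2_smul, AlternatingMap.add_apply, AlternatingMap.smul_apply, smul_eq_algebraMap_mul,
      map_neg, neg_mul, sub_eq_add_neg]
  -- Since T_{1,0} is involutive, every term of dφ on three (1,0)-vectors evaluates φ on two
  -- (1,0)-vectors.
  have h30 : ∀ X ∈ C.T10, ∀ Y ∈ C.T10, ∀ Z ∈ C.T10, d2 φ ![X, Y, Z] = 0 := by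
    intro X hX Y hY Z hZ
    rw [d2_apply, hφ0 _ hX _ hY, hφ0 _ hX _ hZ, hφ0 _ hY _ hZ, hφ0 _ (C.lie_mem_T10 hX hY) _ hZ,
      hφ0 _ (C.lie_mem_T10 hX hZ) _ hY, hφ0 _ (C.lie_mem_T10 hY hZ) _ hX]
    simp
  have h03 : ∀ X ∈ C.T01, ∀ Y ∈ C.T01, ∀ Z ∈ C.T01, d2 φ ![X, Y, Z] = 0 := by
    intro X hX Y hY Z hZ
    rw [← conjFn_conjFn (d2 φ ![X, Y, Z]), ← d2_conjVF hφ,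
      h30 _ (C.conjVF_mem_T10 hX) _ (C.conjVF_mem_T10 hY) _ (C.conjVF_mem_T10 hZ), conjFn_zero]
  have h12 : ∀ X ∈ C.T01, ∀ Y ∈ C.T01, ∀ Z, H ![X, Y, Z] = cI * d2 φ ![X, Y, Z] := by
    intro X hX Y hY Z
    rw [← sub_eq_zero, ← hs, ht X hX Y hY]
  have h21 : ∀ X ∈ C.T10, ∀ Y ∈ C.T10, ∀ Z, H ![X, Y, Z] = -(cI * d2 φ ![X, Y, Z]) := by
    intro X hX Y hY Z
    have h := h12 _ (C.conjVF_mem_T01 hX) _ (C.conjVF_mem_T01 hY) (conjVF Z)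
    rw [hH.apply_three, d2_conjVF hφ] at h
    have h2 := congrArg conjFn h
    rwa [conjFn_conjFn, conjFn_mul, conjFn_conjFn, conjFn_cI, neg_mul] at h2
  have key (X Y Z : VF E M) : H ![X, Y, Z] = cI * (C.delbar φ ![X, Y, Z] - C.del φ ![X, Y, Z]) := by
    -- Among three arguments two have the same type; cyclic rotations bring these to the first two
    -- slots, where `h21` or `h12` applies, and the later rotations restore the order.
    rw [form3_split (C := C) H, del_apply, delbar_apply, form3_rotate H (C.P01 X) (C.P10 Y),
      ← form3_rotate H (C.P10 Z) (C.P10 X) (C.P01 Y), form3_rotate H (C.P10 X) (C.P01 Y) (C.P01 Z),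
      ← form3_rotate H (C.P01 Z) (C.P01 X) (C.P10 Y), h21 _ (C.P10_mem X) _ (C.P10_mem Y),
      h21 _ (C.P10_mem X) _ (C.P10_mem Y), h21 _ (C.P10_mem Y) _ (C.P10_mem Z),
      h21 _ (C.P10_mem Z) _ (C.P10_mem X), h12 _ (C.P01_mem X) _ (C.P01_mem Y),
      h12 _ (C.P01_mem X) _ (C.P01_mem Y), h12 _ (C.P01_mem Y) _ (C.P01_mem Z),
      h12 _ (C.P01_mem Z) _ (C.P01_mem X), h30 _ (C.P10_mem X) _ (C.P10_mem Y) _ (C.P10_mem Z),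
      h03 _ (C.P01_mem X) _ (C.P01_mem Y) _ (C.P01_mem Z),
      ← form3_rotate _ (C.P01 X) (C.P10 Y), form3_rotate _ (C.P10 Z) (C.P10 X) (C.P01 Y),
      ← form3_rotate _ (C.P10 X) (C.P01 Y) (C.P01 Z), form3_rotate _ (C.P01 Z) (C.P01 X) (C.P10 Y)]
    ring
  refine ⟨form3_ext fun X Y Z => ?_, form3_ext fun X Y Z => ?_⟩
  · rw [key, dc, AlternatingMap.smul_apply, AlternatingMap.sub_apply, smul_eq_algebraMap_mul]
  · rw [hs, key, form3_split (C := C) (d2 φ), AlternatingMap.smul_apply, smul_eq_algebraMap_mul,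
      map_mul, map_neg, map_ofNat, del_apply, delbar_apply,
      h30 _ (C.P10_mem X) _ (C.P10_mem Y) _ (C.P10_mem Z),
      h03 _ (C.P01_mem X) _ (C.P01_mem Y) _ (C.P01_mem Z)]
    ring

theorem del_neg : C.del (-φ) = -C.del φ := form3_ext fun X Y Z => by
  rw [del_apply, d2_neg]
  simp only [AlternatingMap.neg_apply, del_apply]
  ring

theorem delbar_neg : C.delbar (-φ) = -C.delbar φ := form3_ext fun X Y Z => by
  rw [delbar_apply, d2_neg]
  simp only [AlternatingMap.neg_apply, delbar_apply]
  ring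

theorem dc_neg : C.dc (-φ) = -C.dc φ := by
  refine form3_ext fun X Y Z => ?_
  rw [dc, dc, del_neg, delbar_neg]
  simp only [AlternatingMap.smul_apply, AlternatingMap.sub_apply, AlternatingMap.neg_apply,
    smul_eq_algebraMap_mul]
  ring

end ComplexStructure

namespace IsCompatiblePair

variable {H : Form 3 E M} {J J' : GT E M →ₗ[Fn E M] GT E M} {k : VF E M ≃ₗ[Fn E M] Form1 E M}

theorem isRealForm_form (h : IsCompatiblePair H J J' k) : IsRealForm h.form := by
  intro v
  change k (h.complexStructure.I (conjVF (v 0))) (conjVF (v 1)) =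
    conjFn (k (h.complexStructure.I (v 0)) (v 1))
  rw [h.complexStructure.real, h.metric_conjVF, conjForm1_apply_conjVF]

/-- On (1,0)-vectors orthogonality reads k(X, Y) = k(iX, iY) = -k(X, Y). -/
theorem form_eq_zero (h : IsCompatiblePair H J J' k) :
    ∀ X ∈ h.complexStructure.T10, ∀ Y ∈ h.complexStructure.T10, h.form ![X, Y] = 0 := by
  intro X hX Y hY
  have h1 := h.orthogonal X Y
  rw [ComplexStructure.mem_T10] at hX hY
  rw [h.form_apply, hX]
  rw [hX, hY] at h1
  simp only [map_smul, LinearMap.smul_apply, smul_eq_mul] at h1 ⊢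
  have h2 : k X Y = 0 := by
    refine eq_of_two_mul_eq ?_
    linear_combination k X Y * cI_mul_cI (E := E) (M := M) - h1
  rw [h2, mul_zero]

theorem dc_eq_and_maninTriple [FiniteDimensional ℝ E] [T2Space M] [IsManifold 𝓘(ℝ, E) ∞ M]
    (h : IsCompatiblePair H J J' k) (hH : IsRealForm H) (hc : IsClosed3 H) :
    h.complexStructure.dc h.form = H ∧
    h.complexStructure.IsHolomorphicManinTriple ((-2 * Complex.I) • h.complexStructure.del h.form)
      (h.complexStructure.GT10 ⊓ (conjSub (eigenbundle J)).map (gauge (-Complex.I • h.form)))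
      (h.complexStructure.GT10 ⊓ (conjSub (eigenbundle J')).map (gauge (-Complex.I • h.form))) := by
  have hm := h.isHolomorphicManinTriple hH hc
  -- The type condition obtained in the reduction is exactly what the torsion identities need; they
  -- in turn rewrite the twist H - i dω as -2i∂ω.
  obtain ⟨h1, h2⟩ := ComplexStructure.dc_eq_and_del_eq hH h.isRealForm_form h.form_eq_zero hm.type
  exact ⟨h1, h2 ▸ hm⟩

end IsCompatiblePair

/-! ### The bi-Hermitian structure -/

namespace IsGeneralizedKahler

variable {H : Form 3 E M} {JA JB : GT E M →ₗ[Fn E M] GT E M}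

theorem metric_pos (h : IsGeneralizedKahler H JA JB) (hs : ∀ X : VF E M, (JA (JB (X, 0))).1 = 0)
    (X : VF E M) (hX : conjVF X = X) (x : M) (hx : ¬ VanishesAt (X, 0) x) :
    0 < (h.metric hs X X x).re := by
  have h1 := h.pos (X, 0) (Prod.ext hX conjForm1_zero) x hx
  rw [h.genA.pairing_skew, (h.isCompatiblePair hs).apply_mk] at h1
  have h2 : -pairing (X, 0) (-((h.metric hs).symm 0), -(h.metric hs X)) = h.metric hs X X := by
    simp [pairing]
  rwa [h2] at h1

/-- The bi-Hermitian structure of a generalized Kähler structure. -/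
noncomputable def biHermitian (h : IsGeneralizedKahler H JA JB)
    (hs : ∀ X : VF E M, (JA (JB (X, 0))).1 = 0) (hH : IsRealForm H) : BiHermitian E M where
  g := h.metric hs
  Xp := (h.isCompatiblePair hs).complexStructure
  Xm := ((h.isCompatiblePair hs).neg hH).complexStructure
  g_symm := (h.isCompatiblePair hs).metric_symm
  g_real X Y := by rw [(h.isCompatiblePair hs).metric_conjVF, conjForm1_apply_conjVF]
  g_pos := h.metric_pos hs
  orth_p := (h.isCompatiblePair hs).orthogonal
  orth_m X Y := by
    have h1 := ((h.isCompatiblePair hs).neg hH).orthogonal X Y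
    change h.metric hs (-_) _ = h.metric hs (-X) Y at h1
    rwa [map_neg, map_neg, LinearMap.neg_apply, LinearMap.neg_apply, neg_inj] at h1

end IsGeneralizedKahler

/-! ### The matrix formula on the two graphs, and uniqueness -/

namespace BiHermitian

variable {H : Form 3 E M} {JA JB : GT E M →ₗ[Fn E M] GT E M} (B : BiHermitian E M)

theorem metric_map_left {C : ComplexStructure E M}
    (orth : ∀ X Y, B.g (C.I X) (C.I Y) = B.g X Y) (X Y : VF E M) :
    B.g (C.I X) Y = -B.g X (C.I Y) := by
  rw [← orth X, C.sq, map_neg, neg_neg]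

/-- Orthogonality makes I skew for g, so I^* = -g I g⁻¹; this removes the duals from the lower right
blocks. -/
theorem metric_comp {C : ComplexStructure E M}
    (orth : ∀ X Y, B.g (C.I X) (C.I Y) = B.g X Y) (α : Form1 E M) :
    α.comp C.I = -B.g (C.I (B.g.symm α)) := by
  ext1 Y
  rw [LinearMap.neg_apply, B.metric_map_left orth, neg_neg, B.g.apply_symm_apply]
  rfl

/-- The formula for `J_A` and `J_B` in terms of their action on the graphs of `g` and `-g`. -/
theorem represents_iff : B.Represents JA JB ↔ ∀ X,
    JA (X, B.g X) = (B.Xp.I X, B.g (B.Xp.I X)) ∧ JB (X, B.g X) = (B.Xp.I X, B.g (B.Xp.I X)) ∧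
    JA (X, -B.g X) = (B.Xm.I X, -B.g (B.Xm.I X)) ∧
    JB (X, -B.g X) = (-B.Xm.I X, B.g (B.Xm.I X)) := by
  have hcp := B.metric_comp B.orth_p
  have hcm := B.metric_comp B.orth_m
  constructor
  · intro h X
    have h1 := h X (B.g X)
    have h2 := h X (-B.g X)
    simp only [LinearMap.comp_add, LinearMap.comp_sub, hcp, hcm, map_neg,
      B.g.symm_apply_apply, LinearMap.add_apply, LinearMap.sub_apply, map_add, map_sub] at h1 h2
    rw [h1.1, h1.2, h2.1, h2.2]
    refine ⟨?_, ?_, ?_, ?_⟩ <;>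
    · refine Prod.ext ?_ ?_ <;>
      · simp only [Prod.smul_fst, Prod.smul_snd]
        module
  · intro h X α
    obtain ⟨Y, rfl⟩ := B.g.surjective α
    -- A generalized vector X + gY splits into its components on the graphs of g and -g, over (X +
    -- Y)/2 and (X - Y)/2.
    have hX : ((X, B.g Y) : GT E M) = (1 / 2 : ℂ) • ((X + Y, B.g (X + Y)) + (X - Y, -B.g (X - Y))) := by
      refine Prod.ext ?_ ?_
      · simp only [Prod.smul_fst, Prod.fst_add]
        module
      · simp only [Prod.smul_snd, Prod.snd_add, map_add, map_sub]
        module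
    have hsm (T : GT E M →ₗ[Fn E M] GT E M) (u : GT E M) : T ((1 / 2 : ℂ) • u) = (1 / 2 : ℂ) • T u := by
      have h1 := T.map_smul (algebraMap ℂ (Fn E M) (1 / 2)) u
      rwa [algebraMap_smul, algebraMap_smul] at h1
    rw [hX, hsm, hsm, map_add JA, map_add JB, (h _).1, (h _).2.1, (h _).2.2.1, (h _).2.2.2]
    simp only [LinearMap.comp_add, LinearMap.comp_sub, hcp, hcm, B.g.symm_apply_apply,
      LinearMap.add_apply, LinearMap.sub_apply, map_add, map_sub]
    refine ⟨?_, ?_⟩ <;>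
    · congr 1
      refine Prod.ext ?_ ?_ <;>
      · simp only [Prod.fst_add, Prod.snd_add]
        abel

theorem map_map_of_represents {B : BiHermitian E M} (h : B.Represents JA JB) (X : VF E M) :
    JA (JB (X, 0)) = (0, -B.g X) := by
  have h1 := fun X => (B.represents_iff.mp h X)
  have hX : (2 : Fn E M) • ((X, 0) : GT E M) = (X, B.g X) + (X, -B.g X) := by
    rw [two_smul]
    simp
  refine eq_of_two_smul_eq (E := E) (M := M) ?_
  have h2 : JA (-B.Xm.I X, B.g (B.Xm.I X)) = (X, -B.g X) := by
    have h3 := (h1 (-B.Xm.I X)).2.2.1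
    rw [map_neg, neg_neg, map_neg, B.Xm.sq, neg_neg] at h3
    exact h3
  refine ((JA ∘ₗ JB).map_smul 2 (X, 0)).symm.trans ?_
  rw [hX, map_add, LinearMap.comp_apply, LinearMap.comp_apply, (h1 X).2.1, (h1 X).2.2.2,
    (h1 _).1, h2, B.Xp.sq, two_smul, map_neg]
  simp

/-- The metric is recovered as -J_A J_B on TM, and then I_± from J_A on the graphs of ±g. -/
theorem eq_of_represents {B B' : BiHermitian E M} (h : B.Represents JA JB)
    (h' : B'.Represents JA JB) : B = B' := by
  have hg : B.g = B'.g := by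
    ext1 X
    have h1 := map_map_of_represents h X
    rw [map_map_of_represents h' X] at h1
    exact (neg_inj.mp (congrArg Prod.snd h1)).symm
  refine BiHermitian.ext hg (ComplexStructure.ext (LinearMap.ext fun X => ?_))
    (ComplexStructure.ext (LinearMap.ext fun X => ?_))
  · have h1 := (B.represents_iff.mp h X).1
    rw [hg, (B'.represents_iff.mp h' X).1] at h1
    exact (congrArg Prod.fst h1).symm
  · have h1 := (B.represents_iff.mp h X).2.2.1
    rw [hg, (B'.represents_iff.mp h' X).2.2.1] at h1
    exact (congrArg Prod.fst h1).symm

end BiHermitian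

/-! ### The Manin triples on X_+ and X_- -/

namespace IsGeneralizedKahler

variable {H : Form 3 E M} {JA JB : GT E M →ₗ[Fn E M] GT E M}

theorem represents (h : IsGeneralizedKahler H JA JB)
    (hs : ∀ X : VF E M, (JA (JB (X, 0))).1 = 0) (hH : IsRealForm H) :
    (h.biHermitian hs hH).Represents JA JB := by
  rw [BiHermitian.represents_iff]
  intro X
  have hk (Y : VF E M) : ((LinearEquiv.neg (Fn E M)).trans (h.metric hs)) Y = -h.metric hs Y :=
    map_neg (h.metric hs) Y
  have h1 := ((h.isCompatiblePair hs).neg hH).map_apply X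
  have h2 := ((h.isCompatiblePair hs).neg hH).map_apply' X
  rw [hk, hk] at h1 h2
  rw [LinearMap.neg_apply, neg_eq_iff_eq_neg] at h2
  refine ⟨(h.isCompatiblePair hs).map_apply X, (h.isCompatiblePair hs).map_apply' X, h1,
    h2.trans (Prod.ext rfl (neg_neg _))⟩

/-- The negated pair has metric -g and complex structure I_-, hence Hermitian form -ω_-. -/
theorem neg_form (h : IsGeneralizedKahler H JA JB)
    (hs : ∀ X : VF E M, (JA (JB (X, 0))).1 = 0) (hH : IsRealForm H) :
    ((h.isCompatiblePair hs).neg hH).form = -(h.biHermitian hs hH).omegaM := by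
  ext1 v
  exact LinearMap.congr_fun (map_neg (h.metric hs)
    (((h.isCompatiblePair hs).neg hH).complexStructure.I (v 0))) (v 1)

theorem Xp_eq (h : IsGeneralizedKahler H JA JB)
    (hs : ∀ X : VF E M, (JA (JB (X, 0))).1 = 0) (hH : IsRealForm H) :
    (h.biHermitian hs hH).Xp = (h.isCompatiblePair hs).complexStructure := rfl

theorem Xm_eq (h : IsGeneralizedKahler H JA JB)
    (hs : ∀ X : VF E M, (JA (JB (X, 0))).1 = 0) (hH : IsRealForm H) :
    (h.biHermitian hs hH).Xm = ((h.isCompatiblePair hs).neg hH).complexStructure := rfl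

theorem omegaP_eq (h : IsGeneralizedKahler H JA JB)
    (hs : ∀ X : VF E M, (JA (JB (X, 0))).1 = 0) (hH : IsRealForm H) :
    (h.biHermitian hs hH).omegaP = (h.isCompatiblePair hs).form := rfl

theorem maninTriple_plus [FiniteDimensional ℝ E] [T2Space M] [IsManifold 𝓘(ℝ, E) ∞ M]
    (h : IsGeneralizedKahler H JA JB)
    (hs : ∀ X : VF E M, (JA (JB (X, 0))).1 = 0) (hH : IsRealForm H) (hc : IsClosed3 H) :
    (h.biHermitian hs hH).Xp.dc (h.biHermitian hs hH).omegaP = H ∧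
    (h.biHermitian hs hH).Xp.IsHolomorphicManinTriple (h.biHermitian hs hH).Hp
      ((h.biHermitian hs hH).Ap JA) ((h.biHermitian hs hH).Bp JB) := by
  rw [BiHermitian.Hp, BiHermitian.Ap, BiHermitian.Bp, omegaP_eq, Xp_eq]
  exact (h.isCompatiblePair hs).dc_eq_and_maninTriple hH hc

/-- The plus-side statement for the negated pair becomes this one by three sign changes:
e^{-i(-ω_-)} = e^{iω_-}, -2i∂(-ω_-) = 2i∂ω_-, and the conjugate of the +i eigenbundle of -J_B is
L_B. The last is why 𝓑_- uses L_B and not L̄_B. -/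
theorem maninTriple_minus [FiniteDimensional ℝ E] [T2Space M] [IsManifold 𝓘(ℝ, E) ∞ M]
    (h : IsGeneralizedKahler H JA JB)
    (hs : ∀ X : VF E M, (JA (JB (X, 0))).1 = 0) (hH : IsRealForm H) (hc : IsClosed3 H) :
    -(h.biHermitian hs hH).Xm.dc (h.biHermitian hs hH).omegaM = H ∧
    (h.biHermitian hs hH).Xm.IsHolomorphicManinTriple (h.biHermitian hs hH).Hm
      ((h.biHermitian hs hH).Am JA) ((h.biHermitian hs hH).Bm JB) := by
  obtain ⟨hm₁, hm₂⟩ := ((h.isCompatiblePair hs).neg hH).dc_eq_and_maninTriple hH hc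
  rw [h.neg_form hs hH] at hm₁ hm₂
  rw [ComplexStructure.dc_neg] at hm₁
  rw [ComplexStructure.del_neg, smul_neg_form, neg_mul, neg_neg, smul_neg_form, neg_neg,
    h.genB.conjSub_eigenbundle_neg] at hm₂
  rw [BiHermitian.Hm, BiHermitian.Am, BiHermitian.Bm, Xm_eq]
  exact ⟨hm₁, hm₂⟩
end IsGeneralizedKahler

end GenKahler

open GenKahler
theorem mainTheorem7 {E M : Type*} [NormedAddCommGroup E] [NormedSpace ℝ E]
    [FiniteDimensional ℝ E] [TopologicalSpace M] [T2Space M] [SecondCountableTopology M]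
    [ChartedSpace E M] [IsManifold 𝓘(ℝ, E) ∞ M]
    (H : Form 3 E M) (H_real : IsRealForm H) (H_closed : IsClosed3 H)
    (JA JB : GT E M →ₗ[Fn E M] GT E M) (hGK : IsGeneralizedKahler H JA JB)
    (h_split : ∀ X : VF E M, (JA (JB (X, 0))).1 = 0) :
    ∃ B : BiHermitian E M,
      B.Represents JA JB ∧
      (∀ B' : BiHermitian E M, B'.Represents JA JB → B' = B) ∧
      B.Xp.dc B.omegaP = H ∧ -B.Xm.dc B.omegaM = H ∧
      B.Xp.IsHolomorphicManinTriple B.Hp (B.Ap JA) (B.Bp JB) ∧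
      B.Xm.IsHolomorphicManinTriple B.Hm (B.Am JA) (B.Bm JB) := by
  have hrep := hGK.represents h_split H_real
  have hp := hGK.maninTriple_plus h_split H_real H_closed
  have hm := hGK.maninTriple_minus h_split H_real H_closed
  exact ⟨hGK.biHermitian h_split H_real, hrep, fun B' h' => BiHermitian.eq_of_represents h' hrep,
    hp.1, hm.1, hp.2, hm.2⟩
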